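/- All Borel spaces are standard and all Hilbert spaces are complex and separable. A \emph{measured groupoid} $(G,C)$ is a Borel groupoid $G$ with unit space $G^{(0)}$, range $r$ and source $s$, and a measure class $C$ on $G$ that is symmetric (invariant under $\gamma\mapsto\gamma^{-1}$) and invariant: some probability measure $\nu\in C$ has a disintegration $(\nu^x)$ along $r$ and there is an $r(C)$-conull Borel set $U\subset G^{(0)}$ such that $\gamma\nu^{s(\gamma)}\sim\nu^{r(\gamma)}$ for all $\gamma\in G|_U=r^{-1}(U)\cap s^{-1}(U)$. Here $r(C)$ is the class of $r_*\nu$, and $G|_U$, for $U$ Borel and conull, is called an inessential reduction. $(G,C)$ is \emph{$r$-discrete} if the range fibres of some inessential reduction are countable, and \emph{ergodic} if every invariant Borel subset of $G^{(0)}$ is $r(C)$-null or conull. A representation $L$ of $(G,C)$ in a Hilbert bundle $\mathcal H$ over $G^{(0)}$ is a Borel family of operators $L(\gamma):\mathcal H(s(\gamma))\to\mathcal H(r(\gamma))$ that is unitary and multiplicative on some inessential reduction. For a Borel section $\xi$ let $c_L(\xi)(\gamma)=\xi(r(\gamma))-L(\gamma)\xi(s(\gamma))$; a unit section is a Borel section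 with $\|\xi(x)\|=1$ for $r(C)$-a.e. $x$. $(G,C)$ has \emph{property $T$} if every representation $L$ with a sequence $(\xi_n)$ of unit sections such that $\|c_L(\xi_n)(\gamma)\|\to0$ for $C$-a.e. $\gamma$ has a unit section $\xi$ with $c_L(\xi)=0$ $C$-a.e. A homomorphism $\varphi:(G_1,C_1)\to(G_2,C_2)$ of $r$-discrete measured groupoids is a Borel map that is, on some inessential reduction of $G_1$, a groupoid homomorphism for which preimages of $r(C_2)$-null Borel sets of units are $r(C_1)$-null. Two homomorphisms satisfy $\varphi\sim\psi$ if on some inessential reduction $G_1|_U$ both are strict in this sense and there is a Borel map $\theta$ from the units to $G_2$ such that $\theta(r(\gamma))\varphi(\gamma)$ and $\psi(\gamma)\theta(s(\gamma))$ are defined and equal for all $\gamma\in G_1|_U$. $(G_1,C_1)$ and $(G_2,C_2)$ are \emph{similar} if there are homomorphisms $\varphi:G_1\to G_2$ and $\psi:G_2\to G_1$ with $\varphi\circ\psi\sim\mathrm{id}_{G_2}$ and $\psi\circ\varphi\sim\mathrm{id}_{G_1}$. Proposition. (a) If two ergodic $r$-discrete measured groupoids are similar, then one has property $T$ if and only if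 the other does. (b) Kazhdan's property $T$ of countable discrete groups is invariant under measure equivalence: if countable groups $\Gamma$, $\Lambda$ have commuting measure preserving Borel actions on a nonzero standard measure space, each with a fundamental domain (up to null sets) of finite measure, then $\Gamma$ has property $T$ if and only if $\Lambda$ does. -/

import Mathlib

open MeasureTheory ProbabilityTheory Filter Topology

-- With this instance removed, `inner ℂ` is read as the inner product of `InnerProductSpace`.
attribute [-instance] WithCStarModule.instCStarModuleComplex

/-- A Borel groupoid with unit space `X` and set of arrows `G`.  The range and source maps are
`rng` and `src`, the inclusion of the units is `one`, and `mul γ₁ γ₂` is the product of the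
composable pair `(γ₁, γ₂)`, that is, of a pair with `src γ₁ = rng γ₂`; the values of `mul` on other
pairs carry no meaning and nothing is required of them. -/
structure BorelGroupoid (X G : Type*) [MeasurableSpace X] [StandardBorelSpace X]
    [MeasurableSpace G] [StandardBorelSpace G] where
  rng : G → X
  src : G → X
  one : X → G
  inv : G → G
  mul : G → G → G
  measurable_rng : Measurable rng
  measurable_src : Measurable src
  measurable_one : Measurable one
  measurable_inv : Measurable inv
  measurable_mul : Measurable fun p : {p : G × G // src p.1 = rng p.2} => mul p.1.1 p.1.2
  rng_one : ∀ x, rng (one x) = x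
  src_one : ∀ x, src (one x) = x
  rng_inv : ∀ γ, rng (inv γ) = src γ
  src_inv : ∀ γ, src (inv γ) = rng γ
  rng_mul : ∀ γ₁ γ₂, src γ₁ = rng γ₂ → rng (mul γ₁ γ₂) = rng γ₁
  src_mul : ∀ γ₁ γ₂, src γ₁ = rng γ₂ → src (mul γ₁ γ₂) = src γ₂
  mul_assoc : ∀ γ₁ γ₂ γ₃, src γ₁ = rng γ₂ → src γ₂ = rng γ₃ →
    mul (mul γ₁ γ₂) γ₃ = mul γ₁ (mul γ₂ γ₃)
  one_mul : ∀ γ, mul (one (rng γ)) γ = γ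
  mul_one : ∀ γ, mul γ (one (src γ)) = γ
  inv_mul : ∀ γ, mul (inv γ) γ = one (src γ)
  mul_inv : ∀ γ, mul γ (inv γ) = one (rng γ)

/-- A measured groupoid: a Borel groupoid with a symmetric invariant measure class `C` on the set
of arrows.  The class is given by a probability measure `meas` in it; everything below depends on
`meas` only through its null sets.  In `invariant`, `ν'` is a probability measure in the class with
disintegration `κ` along `rng`, and left translation by `γ` carries `κ (src γ)` to a measure
equivalent to `κ (rng γ)`, for all arrows `γ` between points of a conull set `U` of units. -/
structure MeasuredGroupoid (X G : Type*) [MeasurableSpace X] [StandardBorelSpace X]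
    [MeasurableSpace G] [StandardBorelSpace G] extends BorelGroupoid X G where
  meas : Measure G
  isProbabilityMeasure : IsProbabilityMeasure meas
  symmetric : meas.map inv ≪ meas ∧ meas ≪ meas.map inv
  invariant : ∃ (ν' : Measure G) (κ : Kernel X G) (U : Set X),
    IsProbabilityMeasure ν' ∧ ν' ≪ meas ∧ meas ≪ ν' ∧
    IsMarkovKernel κ ∧ (∀ x, κ x {γ | rng γ ≠ x} = 0) ∧ (ν'.map rng).bind κ = ν' ∧
    MeasurableSet U ∧ meas.map rng Uᶜ = 0 ∧
    ∀ γ, src γ ∈ U → rng γ ∈ U → ∀ E : Set G, MeasurableSet E →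
      (κ (src γ) {γ₁ | src γ = rng γ₁ ∧ mul γ γ₁ ∈ E} = 0 ↔ κ (rng γ) E = 0)

/-- A bundle of complex Hilbert spaces over a Borel space `X`, with a fundamental sequence of
sections `fund`.  The Borel structure on the total space `{(x, v) : v ∈ fiber x}` is the one
generated by the projection to `X` and the functions `(x, v) ↦ ⟪fund n x, v⟫`. -/
structure HilbertBundle (X : Type*) [MeasurableSpace X] where
  fiber : X → Type
  [normedAddCommGroup : ∀ x, NormedAddCommGroup (fiber x)]
  [innerProductSpace : ∀ x, InnerProductSpace ℂ (fiber x)]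
  [completeSpace : ∀ x, CompleteSpace (fiber x)]
  fund : ℕ → ∀ x, fiber x
  measurable_inner_fund : ∀ m n, Measurable fun x => inner ℂ (fund m x) (fund n x)
  separating : ∀ x (v w : fiber x), (∀ n, inner ℂ (fund n x) v = inner ℂ (fund n x) w) → v = w

attribute [instance] HilbertBundle.normedAddCommGroup HilbertBundle.innerProductSpace
  HilbertBundle.completeSpace

/-- The Borel structure of the total space of a Hilbert bundle. -/
@[reducible] noncomputable def HilbertBundle.totalBorel {X : Type*} [MeasurableSpace X] (E : HilbertBundle X) :
    MeasurableSpace (Σ x, E.fiber x) :=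
  MeasurableSpace.comap Sigma.fst inferInstance ⊔
    ⨆ n, MeasurableSpace.comap (fun p => inner ℂ (E.fund n p.1) p.2) (borel ℂ)

/-- Borel sections of a Hilbert bundle. -/
def HilbertBundle.IsBorelSection {X : Type*} [MeasurableSpace X] (E : HilbertBundle X)
    (ξ : ∀ x, E.fiber x) : Prop :=
  @Measurable X (Σ x, E.fiber x) _ E.totalBorel fun x => ⟨x, ξ x⟩

section

variable {X G : Type*} [MeasurableSpace X] [StandardBorelSpace X]
  [MeasurableSpace G] [StandardBorelSpace G]

/-- The image `r(C)` of the measure class on the space of units. -/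
noncomputable def MeasuredGroupoid.unitMeas (𝒢 : MeasuredGroupoid X G) : Measure X :=
  𝒢.meas.map 𝒢.rng

/-- A Borel conull set `U` of units, i.e. one that defines an inessential reduction `G|_U`. -/
def MeasuredGroupoid.IsConull (𝒢 : MeasuredGroupoid X G) (U : Set X) : Prop :=
  MeasurableSet U ∧ 𝒢.unitMeas Uᶜ = 0

/-- `r`-discreteness: in some inessential reduction, all fibres of the range map are countable. -/
def MeasuredGroupoid.IsRDiscrete (𝒢 : MeasuredGroupoid X G) : Prop :=
  ∃ U, 𝒢.IsConull U ∧ ∀ x ∈ U, {γ : G | 𝒢.rng γ = x ∧ 𝒢.src γ ∈ U}.Countable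

/-- Ergodicity: every invariant Borel set of units is null or conull. -/
def MeasuredGroupoid.IsErgodic (𝒢 : MeasuredGroupoid X G) : Prop :=
  ∀ A : Set X, MeasurableSet A → (∀ γ, 𝒢.src γ ∈ A ↔ 𝒢.rng γ ∈ A) →
    𝒢.unitMeas A = 0 ∨ 𝒢.unitMeas Aᶜ = 0

/-- A representation of a measured groupoid: a Hilbert bundle over the units and Borel operators
`op γ : fiber (src γ) → fiber (rng γ)` that, on some inessential reduction `G|_U`, are isometric
and multiplicative, hence unitary with `op (inv γ) = (op γ)⁻¹`.  The arguments `x`, `y` of `op γ`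
are the source and the range of `γ`.  Outside `G|_U` only Borel measurability is required. -/
structure MeasuredGroupoid.Representation (𝒢 : MeasuredGroupoid X G) where
  bundle : HilbertBundle X
  op : ∀ (γ : G) (x y : X), 𝒢.src γ = x → 𝒢.rng γ = y → (bundle.fiber x →L[ℂ] bundle.fiber y)
  measurable_op : ∀ m n, Measurable fun γ =>
    inner ℂ (bundle.fund m (𝒢.rng γ)) (op γ _ _ rfl rfl (bundle.fund n (𝒢.src γ)))
  exists_strict : ∃ U, 𝒢.IsConull U ∧
    (∀ γ x y (hs : 𝒢.src γ = x) (hr : 𝒢.rng γ = y), x ∈ U → y ∈ U →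
      ∀ v, ‖op γ x y hs hr v‖ = ‖v‖) ∧
    (∀ x ∈ U, ∀ v, op (𝒢.one x) x x (𝒢.src_one x) (𝒢.rng_one x) v = v) ∧
    (∀ γ₁ γ₂ x y z (hs₂ : 𝒢.src γ₂ = x) (hr₂ : 𝒢.rng γ₂ = y) (hs₁ : 𝒢.src γ₁ = y)
      (hr₁ : 𝒢.rng γ₁ = z), x ∈ U → y ∈ U → z ∈ U → ∀ v,
        op (𝒢.mul γ₁ γ₂) x z ((𝒢.src_mul γ₁ γ₂ (hs₁.trans hr₂.symm)).trans hs₂)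
          ((𝒢.rng_mul γ₁ γ₂ (hs₁.trans hr₂.symm)).trans hr₁) v =
        op γ₁ y z hs₁ hr₁ (op γ₂ x y hs₂ hr₂ v))

/-- The coboundary `c_L(ξ) : γ ↦ ξ (rng γ) - L(γ) ξ (src γ)` of a section `ξ`. -/
noncomputable def MeasuredGroupoid.Representation.coboundary {𝒢 : MeasuredGroupoid X G}
    (L : 𝒢.Representation) (ξ : ∀ x, L.bundle.fiber x) (γ : G) : L.bundle.fiber (𝒢.rng γ) :=
  ξ (𝒢.rng γ) - L.op γ _ _ rfl rfl (ξ (𝒢.src γ))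

/-- Unit sections: Borel sections of norm one almost everywhere. -/
def MeasuredGroupoid.Representation.IsUnitSection {𝒢 : MeasuredGroupoid X G}
    (L : 𝒢.Representation) (ξ : ∀ x, L.bundle.fiber x) : Prop :=
  L.bundle.IsBorelSection ξ ∧ ∀ᵐ x ∂𝒢.unitMeas, ‖ξ x‖ = 1

/-- `L` contains a unit invariant section. -/
def MeasuredGroupoid.Representation.HasUnitInvariantSection {𝒢 : MeasuredGroupoid X G}
    (L : 𝒢.Representation) : Prop :=
  ∃ ξ, L.IsUnitSection ξ ∧ ∀ᵐ γ ∂𝒢.meas, L.coboundary ξ γ = 0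

/-- `L` almost contains unit invariant sections. -/
def MeasuredGroupoid.Representation.AlmostHasUnitInvariantSections {𝒢 : MeasuredGroupoid X G}
    (L : 𝒢.Representation) : Prop :=
  ∃ ξ : ℕ → ∀ x, L.bundle.fiber x, (∀ n, L.IsUnitSection (ξ n)) ∧
    ∀ᵐ γ ∂𝒢.meas, Tendsto (fun n => ‖L.coboundary (ξ n) γ‖) atTop (𝓝 0)

/-- Property `T` of a measured groupoid. -/
def MeasuredGroupoid.HasPropertyT (𝒢 : MeasuredGroupoid X G) : Prop :=
  ∀ L : 𝒢.Representation, L.AlmostHasUnitInvariantSections → L.HasUnitInvariantSection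

variable {X' G' : Type*} [MeasurableSpace X'] [StandardBorelSpace X']
  [MeasurableSpace G'] [StandardBorelSpace G']

/-- The map induced on the units by a map `φ` between the arrows of two groupoids. -/
def MeasuredGroupoid.unitMap (𝒢 : MeasuredGroupoid X G) (𝒢' : MeasuredGroupoid X' G')
    (φ : G → G') (x : X) : X' :=
  𝒢'.rng (φ (𝒢.one x))

/-- The restriction of `φ` to the reduction `G|_U` is a strict homomorphism of `r`-discrete
measured groupoids: it preserves the operations, and preimages in `U` of null sets of units are
null. -/
def MeasuredGroupoid.IsStrictHomOn (𝒢 : MeasuredGroupoid X G) (𝒢' : MeasuredGroupoid X' G')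
    (φ : G → G') (U : Set X) : Prop :=
  (∀ x ∈ U, φ (𝒢.one x) = 𝒢'.one (𝒢.unitMap 𝒢' φ x)) ∧
  (∀ γ, 𝒢.src γ ∈ U → 𝒢.rng γ ∈ U →
    𝒢'.src (φ γ) = 𝒢.unitMap 𝒢' φ (𝒢.src γ) ∧ 𝒢'.rng (φ γ) = 𝒢.unitMap 𝒢' φ (𝒢.rng γ) ∧
    φ (𝒢.inv γ) = 𝒢'.inv (φ γ)) ∧
  (∀ γ₁ γ₂, 𝒢.src γ₁ = 𝒢.rng γ₂ → 𝒢.src γ₂ ∈ U → 𝒢.rng γ₂ ∈ U → 𝒢.rng γ₁ ∈ U →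
    φ (𝒢.mul γ₁ γ₂) = 𝒢'.mul (φ γ₁) (φ γ₂)) ∧
  (∀ E : Set X', MeasurableSet E → 𝒢'.unitMeas E = 0 →
    𝒢.unitMeas (U ∩ 𝒢.unitMap 𝒢' φ ⁻¹' E) = 0)

/-- Homomorphisms of `r`-discrete measured groupoids: Borel maps that are strict homomorphisms on
some inessential reduction. -/
def MeasuredGroupoid.IsHom (𝒢 : MeasuredGroupoid X G) (𝒢' : MeasuredGroupoid X' G')
    (φ : G → G') : Prop :=
  Measurable φ ∧ ∃ U, 𝒢.IsConull U ∧ 𝒢.IsStrictHomOn 𝒢' φ U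

/-- Similarity `φ ∼ ψ` of homomorphisms: on some inessential reduction both are strict and they
are intertwined by a Borel map `θ` from the units of `𝒢` to the arrows of `𝒢'`. -/
def MeasuredGroupoid.SimilarHoms (𝒢 : MeasuredGroupoid X G) (𝒢' : MeasuredGroupoid X' G')
    (φ ψ : G → G') : Prop :=
  ∃ U, 𝒢.IsConull U ∧ 𝒢.IsStrictHomOn 𝒢' φ U ∧ 𝒢.IsStrictHomOn 𝒢' ψ U ∧
    ∃ θ : X → G', Measurable θ ∧ ∀ γ, 𝒢.src γ ∈ U → 𝒢.rng γ ∈ U →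
      𝒢'.src (θ (𝒢.rng γ)) = 𝒢'.rng (φ γ) ∧ 𝒢'.src (ψ γ) = 𝒢'.rng (θ (𝒢.src γ)) ∧
      𝒢'.mul (θ (𝒢.rng γ)) (φ γ) = 𝒢'.mul (ψ γ) (θ (𝒢.src γ))

/-- Similarity of `r`-discrete measured groupoids. -/
def MeasuredGroupoid.Similar (𝒢 : MeasuredGroupoid X G) (𝒢' : MeasuredGroupoid X' G') : Prop :=
  ∃ (φ : G → G') (ψ : G' → G), 𝒢.IsHom 𝒢' φ ∧ 𝒢'.IsHom 𝒢 ψ ∧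
    𝒢'.SimilarHoms 𝒢' (φ ∘ ψ) id ∧ 𝒢.SimilarHoms 𝒢 (ψ ∘ φ) id

end

/-- Kazhdan's property `T` of a countable discrete group, with separable complex Hilbert spaces. -/
def GroupHasPropertyT (Γ : Type*) [Group Γ] : Prop :=
  ∀ (H : Type) [NormedAddCommGroup H] [InnerProductSpace ℂ H] [CompleteSpace H]
    [TopologicalSpace.SeparableSpace H] (π : Γ →* (H ≃ₗᵢ[ℂ] H)),
    (∀ (Q : Finset Γ) (ε : ℝ), 0 < ε → ∃ v : H, ‖v‖ = 1 ∧ ∀ g ∈ Q, ‖π g v - v‖ < ε) →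
    ∃ v : H, ‖v‖ = 1 ∧ ∀ g, π g v = v

/-- Measure equivalence of countable discrete groups: there are commuting measure preserving
Borel actions on a nonzero standard measure space, each with a fundamental domain of finite
measure. -/
def MeasureEquivalent (Γ Λ : Type*) [Group Γ] [Group Λ] : Prop :=
  ∃ (Ω : Type) (_ : MeasurableSpace Ω) (_ : StandardBorelSpace Ω) (_ : MulAction Γ Ω)
    (_ : MulAction Λ Ω) (m : Measure Ω), m ≠ 0 ∧ SMulCommClass Γ Λ Ω ∧
    (∀ g : Γ, MeasurePreserving (fun ω : Ω => g • ω) m m) ∧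
    (∀ h : Λ, MeasurePreserving (fun ω : Ω => h • ω) m m) ∧
    (∃ A : Set Ω, IsFundamentalDomain Γ A m ∧ m A < ⊤) ∧
    (∃ B : Set Ω, IsFundamentalDomain Λ B m ∧ m B < ⊤)

/-! ### Measurability of inner products in Hilbert bundles -/

section bundle

variable {X : Type*} [MeasurableSpace X]

/-! (a) Let `L` represent the first groupoid and have almost invariant unit sections. Its pullback
along `ψ` has them too, so property `T` of the second groupoid gives an invariant unit section `η`
of the pullback. If `q` is the unit map of `φ` and `θ` implements `ψ ∘ φ ∼ id`, then `x ↦ L (θ x) η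
(q x)` is a unit section, invariant because `θ (r γ) · ψ (φ γ) = γ · θ (s γ)`. The obstacle is that
homomorphisms control null sets of units only, so "almost every arrow" need not pull back. In an
`r`-discrete groupoid it becomes "every arrow of some inessential reduction"
(`IsRDiscrete.exists_isConull_forall_notMem`), which does.

(b) This is proved by induction of representations, without groupoids. Let `π` be a representation
of `Γ` with almost invariant unit vectors `v n`, and let `a : Ω → Γ` be the equivariant map given by
a `Γ`-fundamental domain. The maps `ω ↦ π (a ω) (v n)` are almost invariant in the space of square
integrable `Γ`-equivariant maps, on which `Λ` acts by `inducedRep`. Property `T` of `Λ` yields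
`Λ`-invariant vectors close to them (`GroupHasPropertyT.exists_invariant_tendsto`). Such a vector is
a `Γ`-equivariant, `Λ`-invariant map, so after truncation its integral over a `Λ`-fundamental domain
`B` is fixed by `Γ` (`map_setIntegral_eq`). Along a subsequence this integral is asymptotic to `m B
• v n`, hence eventually nonzero. -/

theorem HilbertBundle.isBorelSection_iff (E : HilbertBundle X) (ξ : ∀ x, E.fiber x) :
    E.IsBorelSection ξ ↔ ∀ n, Measurable fun x => (inner ℂ (E.fund n x) (ξ x) : ℂ) := by
  have hb : borel ℂ = (inferInstance : MeasurableSpace ℂ) := (BorelSpace.measurable_eq).symm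
  unfold HilbertBundle.IsBorelSection HilbertBundle.totalBorel
  rw [measurable_iff_comap_le, MeasurableSpace.comap_sup, MeasurableSpace.comap_iSup, sup_le_iff,
    iSup_le_iff]
  simp only [MeasurableSpace.comap_comp, hb, measurable_iff_comap_le]
  constructor
  · rintro ⟨-, h⟩ n
    exact h n
  · intro h
    refine ⟨?_, h⟩
    exact (measurable_id : Measurable fun x : X => x).comap_le

/-- Linear combinations of the fundamental sections with coefficients in a countable dense set. -/
noncomputable def HilbertBundle.comb (E : HilbertBundle X) (c : Σ s : Finset ℕ, (s → ℕ)) (x : X) :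
    E.fiber x :=
  ∑ i, (TopologicalSpace.denseSeq ℂ (c.2 i)) • E.fund i x

/-- A vector orthogonal to all fundamental sections vanishes by `separating`, so their span is
dense; its coefficients can then be perturbed into a countable dense set. Countability lets suprema
over `c` stay measurable. -/
theorem HilbertBundle.denseRange_comb (E : HilbertBundle X) (x : X) :
    DenseRange fun c => E.comb c x := by
  have h1 : (Submodule.span ℂ (Set.range fun n => E.fund n x)).topologicalClosure = ⊤ := by
    rw [Submodule.topologicalClosure_eq_top_iff, Submodule.eq_bot_iff]
    intro v hv
    refine E.separating x v 0 fun n => ?_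
    rw [inner_zero_right]
    exact (Submodule.mem_orthogonal _ v).1 hv _ (Submodule.subset_span ⟨n, rfl⟩)
  have h2 : (Submodule.span ℂ (Set.range fun n => E.fund n x) : Set (E.fiber x)) ⊆
      closure (Set.range fun c => E.comb c x) := by
    intro v hv
    obtain ⟨l, rfl⟩ := Finsupp.mem_span_range_iff_exists_finsupp.1 hv
    have hd : DenseRange (Pi.map fun (_ : l.support) => TopologicalSpace.denseSeq ℂ) :=
      DenseRange.piMap fun _ => TopologicalSpace.denseRange_denseSeq ℂ
    have hc : Continuous fun z : l.support → ℂ => ∑ i, z i • E.fund i x := by fun_prop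
    have := hc.range_subset_closure_image_dense hd ⟨fun i => l i, rfl⟩
    rw [Finsupp.sum, ← Finset.sum_coe_sort]
    refine closure_mono ?_ this
    rintro _ ⟨_, ⟨k, rfl⟩, rfl⟩
    exact ⟨⟨l.support, k⟩, rfl⟩
  intro v
  have hv : v ∈ (Submodule.span ℂ (Set.range fun n => E.fund n x)).topologicalClosure := by
    rw [h1]; trivial
  exact closure_minimal h2 isClosed_closure hv

/-- Completing the square turns each term into `‖v‖ ^ 2 - ‖w c - v‖ ^ 2`. Only inner products with
the `w c` enter, so norms of Borel sections become measurable, and inner products follow by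
polarization. -/
theorem norm_sq_eq_ciSup_of_denseRange {H ι : Type*} [NormedAddCommGroup H]
    [InnerProductSpace ℂ H] {w : ι → H} (hw : DenseRange w) (v : H) :
    ‖v‖ ^ 2 = ⨆ c, (2 * (inner ℂ (w c) v : ℂ).re - ‖w c‖ ^ 2) := by
  have key : ∀ c, 2 * (inner ℂ (w c) v : ℂ).re - ‖w c‖ ^ 2 = ‖v‖ ^ 2 - ‖w c - v‖ ^ 2 := by
    intro c
    have := norm_sub_sq (𝕜 := ℂ) (w c) v
    simp only [RCLike.re_to_complex] at this
    linarith
  have : Nonempty ι := hw.nonempty_iff.2 ⟨v⟩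
  simp only [key]
  refine le_antisymm ?_ (ciSup_le fun c => by nlinarith [sq_nonneg ‖w c - v‖])
  refine le_of_forall_pos_lt_add fun ε hε => ?_
  obtain ⟨c, hc⟩ := hw.exists_dist_lt v (Real.sqrt_pos.2 hε)
  have h2 : ‖w c - v‖ ^ 2 < ε := by
    rw [dist_eq_norm, ← norm_neg, neg_sub] at hc
    exact (Real.lt_sqrt (norm_nonneg _)).1 hc
  have h3 : ‖v‖ ^ 2 - ‖w c - v‖ ^ 2 ≤ ⨆ c, (‖v‖ ^ 2 - ‖w c - v‖ ^ 2) :=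
    le_ciSup (f := fun c => ‖v‖ ^ 2 - ‖w c - v‖ ^ 2)
      ⟨‖v‖ ^ 2, by rintro _ ⟨c, rfl⟩; nlinarith [sq_nonneg ‖w c - v‖]⟩ c
  linarith

variable {E : HilbertBundle X}

theorem HilbertBundle.IsBorelSection.measurable_inner_comb {ξ : ∀ x, E.fiber x}
    (hξ : E.IsBorelSection ξ) (c : Σ s : Finset ℕ, (s → ℕ)) :
    Measurable fun x => (inner ℂ (E.comb c x) (ξ x) : ℂ) := by
  simp only [HilbertBundle.comb, sum_inner, inner_smul_left]
  exact Finset.measurable_sum _ fun i _ => ((E.isBorelSection_iff ξ).1 hξ i).const_mul _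

theorem HilbertBundle.isBorelSection_comb (c : Σ s : Finset ℕ, (s → ℕ)) :
    E.IsBorelSection (E.comb c) := by
  rw [E.isBorelSection_iff]
  intro n
  simp only [HilbertBundle.comb, inner_sum, inner_smul_right]
  exact Finset.measurable_sum _ fun i _ => (E.measurable_inner_fund n i).const_mul _

theorem HilbertBundle.IsBorelSection.measurable_norm_sq {ξ : ∀ x, E.fiber x}
    (hξ : E.IsBorelSection ξ) : Measurable fun x => ‖ξ x‖ ^ 2 := by
  have h : (fun x => ‖ξ x‖ ^ 2) = fun x => ⨆ c, (2 * (inner ℂ (E.comb c x) (ξ x) : ℂ).re -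
      (inner ℂ (E.comb c x) (E.comb c x) : ℂ).re) := by
    funext x
    rw [norm_sq_eq_ciSup_of_denseRange (E.denseRange_comb x)]
    congr 1
    funext c
    congr 1
    exact (inner_self_eq_norm_sq (𝕜 := ℂ) _).symm
  rw [h]
  refine Measurable.iSup fun c => ?_
  exact ((Complex.measurable_re.comp (hξ.measurable_inner_comb c)).const_mul 2).sub
    (Complex.measurable_re.comp ((HilbertBundle.isBorelSection_comb c).measurable_inner_comb c))

theorem HilbertBundle.IsBorelSection.add {ξ η : ∀ x, E.fiber x} (hξ : E.IsBorelSection ξ)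
    (hη : E.IsBorelSection η) : E.IsBorelSection fun x => ξ x + η x := by
  rw [E.isBorelSection_iff] at *
  intro n
  simp only [inner_add_right]
  exact (hξ n).add (hη n)

theorem HilbertBundle.IsBorelSection.const_smul {ξ : ∀ x, E.fiber x} (hξ : E.IsBorelSection ξ)
    (c : ℂ) : E.IsBorelSection fun x => c • ξ x := by
  rw [E.isBorelSection_iff] at *
  intro n
  simp only [inner_smul_right]
  exact (hξ n).const_mul c

theorem HilbertBundle.IsBorelSection.sub {ξ η : ∀ x, E.fiber x} (hξ : E.IsBorelSection ξ)
    (hη : E.IsBorelSection η) : E.IsBorelSection fun x => ξ x - η x := by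
  rw [E.isBorelSection_iff] at *
  intro n
  simp only [inner_sub_right]
  exact (hξ n).sub (hη n)

theorem HilbertBundle.IsBorelSection.measurable_inner {ξ η : ∀ x, E.fiber x}
    (hξ : E.IsBorelSection ξ) (hη : E.IsBorelSection η) :
    Measurable fun x => (inner ℂ (ξ x) (η x) : ℂ) := by
  simp only [inner_eq_sum_norm_sq_div_four (𝕜 := ℂ)]
  have h : ∀ {ζ : ∀ x, E.fiber x}, E.IsBorelSection ζ →
      Measurable fun x => (RCLike.ofReal ‖ζ x‖ : ℂ) ^ 2 := by
    intro ζ hζ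
    have := Complex.measurable_ofReal.comp hζ.measurable_norm_sq
    simpa [Function.comp_def] using this
  exact ((((h (hξ.add hη)).sub (h (hξ.sub hη))).add
    (((h (hξ.sub (hη.const_smul _))).sub (h (hξ.add (hη.const_smul _)))).mul_const _))).div_const _

/-- The pullback of a Hilbert bundle along a Borel map. -/
@[reducible] noncomputable def HilbertBundle.pullback {Y : Type*} [MeasurableSpace Y]
    (E : HilbertBundle X) (f : Y → X) (hf : Measurable f) : HilbertBundle Y where
  fiber y := E.fiber (f y)
  fund n y := E.fund n (f y)
  measurable_inner_fund m n := (E.measurable_inner_fund m n).comp hf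
  separating y := E.separating (f y)

theorem HilbertBundle.IsBorelSection.pullback {Y : Type*} [MeasurableSpace Y]
    {ξ : ∀ x, E.fiber x} (hξ : E.IsBorelSection ξ) {f : Y → X} (hf : Measurable f) :
    (E.pullback f hf).IsBorelSection fun y => ξ (f y) := by
  rw [isBorelSection_iff] at *
  exact fun n => (hξ n).comp hf

end bundle

/-! ### Null sets in `r`-discrete measured groupoids -/

namespace MeasuredGroupoid

variable {X G : Type*} [MeasurableSpace X] [StandardBorelSpace X]
  [MeasurableSpace G] [StandardBorelSpace G] {𝒢 : MeasuredGroupoid X G}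

theorem mul_left_cancel {γ₁ γ₂ : G} (h : 𝒢.src γ₁ = 𝒢.rng γ₂) (e : 𝒢.mul γ₁ γ₂ = γ₁) :
    γ₂ = 𝒢.one (𝒢.src γ₁) := by
  have h1 := 𝒢.mul_assoc (𝒢.inv γ₁) γ₁ γ₂ (𝒢.src_inv γ₁) h
  rw [𝒢.inv_mul, e, 𝒢.inv_mul, h, 𝒢.one_mul] at h1
  rw [h1, h]

theorem unitMeas_apply {A : Set X} (hA : MeasurableSet A) :
    𝒢.unitMeas A = 𝒢.meas (𝒢.rng ⁻¹' A) :=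
  Measure.map_apply 𝒢.measurable_rng hA

theorem meas_src_preimage_eq_zero_iff {A : Set X} (hA : MeasurableSet A) :
    𝒢.meas (𝒢.src ⁻¹' A) = 0 ↔ 𝒢.meas (𝒢.rng ⁻¹' A) = 0 := by
  have e : 𝒢.meas.map 𝒢.inv (𝒢.rng ⁻¹' A) = 𝒢.meas (𝒢.src ⁻¹' A) := by
    rw [Measure.map_apply 𝒢.measurable_inv (𝒢.measurable_rng hA)]
    congr 1
    ext γ
    simp [𝒢.rng_inv]
  rw [← e]
  exact ⟨fun h => 𝒢.symmetric.2 h, fun h => 𝒢.symmetric.1 h⟩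

theorem IsConull.inter {U V : Set X} (hU : 𝒢.IsConull U) (hV : 𝒢.IsConull V) :
    𝒢.IsConull (U ∩ V) :=
  ⟨hU.1.inter hV.1, by rw [Set.compl_inter]; exact measure_union_null hU.2 hV.2⟩

theorem exists_isConull_of_ae {p : X → Prop} (h : ∀ᵐ x ∂𝒢.unitMeas, p x) :
    ∃ U, 𝒢.IsConull U ∧ ∀ x ∈ U, p x := by
  refine ⟨(toMeasurable 𝒢.unitMeas {x | ¬ p x})ᶜ,
    ⟨(measurableSet_toMeasurable _ _).compl, by
      rw [compl_compl, measure_toMeasurable]; exact h⟩, fun x hx => ?_⟩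
  by_contra hp
  exact hx (subset_toMeasurable _ _ hp)

theorem IsConull.ae_mem {U : Set X} (hU : 𝒢.IsConull U) : ∀ᵐ x ∂𝒢.unitMeas, x ∈ U := hU.2

theorem IsConull.ae_src_rng_mem {U : Set X} (hU : 𝒢.IsConull U) :
    ∀ᵐ γ ∂𝒢.meas, 𝒢.src γ ∈ U ∧ 𝒢.rng γ ∈ U := by
  have h := hU.2
  rw [unitMeas_apply hU.1.compl] at h
  have h' := (meas_src_preimage_eq_zero_iff hU.1.compl).2 h
  filter_upwards [measure_eq_zero_iff_ae_notMem.1 h, measure_eq_zero_iff_ae_notMem.1 h']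
    with γ h1 h2
  exact ⟨not_not.1 h2, not_not.1 h1⟩

/-- In an `r`-discrete measured groupoid a null set of arrows misses an inessential reduction. -/
theorem IsRDiscrete.exists_isConull_forall_notMem (hd : 𝒢.IsRDiscrete) {N : Set G}
    (hN : 𝒢.meas N = 0) : ∃ V, 𝒢.IsConull V ∧ ∀ γ, 𝒢.src γ ∈ V → 𝒢.rng γ ∈ V → γ ∉ N := by
  wlog hNm : MeasurableSet N generalizing N
  · obtain ⟨V, hV, h⟩ := this (N := toMeasurable 𝒢.meas N) (by rwa [measure_toMeasurable])
      (measurableSet_toMeasurable _ _)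
    exact ⟨V, hV, fun γ h1 h2 h3 => h γ h1 h2 (subset_toMeasurable _ _ h3)⟩
  obtain ⟨ν, κ, U, -, hν₁, hν₂, hκ, hfib, hbind, hUm, hU0, hinv⟩ := 𝒢.invariant
  obtain ⟨U', hU', hcount⟩ := hd
  have hU : 𝒢.IsConull U := ⟨hUm, hU0⟩
  set W := U ∩ U' with hWdef
  have hW : 𝒢.IsConull W := hU.inter hU'
  have hrng : ν.map 𝒢.rng ≪ 𝒢.unitMeas := hν₁.map 𝒢.measurable_rng
  have hrng' : 𝒢.unitMeas ≪ ν.map 𝒢.rng := hν₂.map 𝒢.measurable_rng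
  have fibre_null : ∀ S : Set G, MeasurableSet S → 𝒢.meas S = 0 →
      ∀ᵐ x ∂𝒢.unitMeas, κ x S = 0 := by
    intro S hS h0
    have h1 : ν S = 0 := hν₁ h0
    rw [← hbind, Measure.bind_apply hS κ.measurable.aemeasurable,
      lintegral_eq_zero_iff (κ.measurable_coe hS)] at h1
    exact hrng'.ae_le h1
  have hGW : MeasurableSet {γ : G | 𝒢.src γ ∈ W ∧ 𝒢.rng γ ∈ W} :=
    (𝒢.measurable_src hW.1).inter (𝒢.measurable_rng hW.1)
  -- Invariance is tested on singletons: the only arrow that left translation by `γ` carries to `γ`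
  -- is the unit at its source.
  have mul_mem : ∀ γ, {γ₁ | 𝒢.src γ = 𝒢.rng γ₁ ∧ 𝒢.mul γ γ₁ ∈ ({γ} : Set G)} =
      {𝒢.one (𝒢.src γ)} := by
    intro γ
    ext γ₁
    simp only [Set.mem_ofPred_eq, Set.mem_singleton_iff]
    constructor
    · rintro ⟨h1, h2⟩
      exact mul_left_cancel h1 h2
    · rintro rfl
      exact ⟨(𝒢.rng_one _).symm, 𝒢.mul_one γ⟩
  have atom_iff : ∀ γ, 𝒢.src γ ∈ U → 𝒢.rng γ ∈ U →
      (κ (𝒢.src γ) {𝒢.one (𝒢.src γ)} = 0 ↔ κ (𝒢.rng γ) {γ} = 0) := by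
    intro γ h1 h2
    rw [← mul_mem]
    exact hinv γ h1 h2 _ (measurableSet_singleton γ)
  -- The units charged by their own fibre measure. By `atom_iff`, an arrow between points of `U` is
  -- an atom of its range fibre iff its source lies in `A`.
  set A : Set X := {x | κ x {𝒢.one x} ≠ 0} with hAdef
  have hAm : MeasurableSet A := by
    have hgr : MeasurableSet {p : X × G | p.2 = 𝒢.one p.1} :=
      measurableSet_eq_fun measurable_snd (𝒢.measurable_one.comp measurable_fst)
    exact (Kernel.measurable_kernel_prodMk_left (κ := κ) hgr)
      (measurableSet_singleton (0 : ENNReal)).compl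
  have hA : 𝒢.IsConull A := by
    refine ⟨hAm, ?_⟩
    rw [unitMeas_apply hAm.compl, ← meas_src_preimage_eq_zero_iff hAm.compl]
    refine hν₂ ?_
    rw [← hbind, Measure.bind_apply (𝒢.measurable_src hAm.compl) κ.measurable.aemeasurable,
      lintegral_eq_zero_iff (κ.measurable_coe (𝒢.measurable_src hAm.compl))]
    refine hrng.ae_le ?_
    -- Up to null sets, the arrows of the fibre over `x` with source outside `A` are non-atoms in a
    -- countable set, so they have total mass zero.
    filter_upwards [hW.ae_mem, fibre_null _ hGW.compl hW.ae_src_rng_mem] with x hxW hx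
    have hle : 𝒢.src ⁻¹' Aᶜ ⊆ ({γ | 𝒢.src γ ∈ W ∧ 𝒢.rng γ ∈ W}ᶜ ∪ {γ | 𝒢.rng γ ≠ x}) ∪
        {γ | (𝒢.rng γ = x ∧ 𝒢.src γ ∈ U') ∧ κ x {γ} = 0} := by
      intro γ hγ
      by_cases h1 : 𝒢.src γ ∈ W ∧ 𝒢.rng γ ∈ W
      · by_cases h2 : 𝒢.rng γ = x
        · refine Or.inr ⟨⟨h2, h1.1.2⟩, ?_⟩
          rw [← h2, ← atom_iff γ h1.1.1 h1.2.1]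
          exact not_not.1 hγ
        · exact Or.inl (Or.inr h2)
      · exact Or.inl (Or.inl h1)
    refine measure_mono_null hle (measure_union_null (measure_union_null hx (hfib x)) ?_)
    have hc : {γ | (𝒢.rng γ = x ∧ 𝒢.src γ ∈ U') ∧ κ x {γ} = 0}.Countable :=
      (hcount x hxW.2).mono fun γ hγ => hγ.1
    rw [← Set.biUnion_of_singleton {γ | (𝒢.rng γ = x ∧ 𝒢.src γ ∈ U') ∧ κ x {γ} = 0}]
    exact (measure_biUnion_null_iff hc).2 fun γ hγ => hγ.2
  obtain ⟨V', hV', hκN⟩ := exists_isConull_of_ae (fibre_null N hNm hN)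
  refine ⟨W ∩ A ∩ V', (hW.inter hA).inter hV', fun γ hs hr hγ => ?_⟩
  -- An arrow of `N` in this reduction would be an atom of `κ (rng γ)`, which gives `N` mass zero.
  refine hs.1.2 ((atom_iff γ hs.1.1.1 hr.1.1.1).2 ?_)
  exact measure_mono_null (Set.singleton_subset_iff.2 hγ) (hκN _ hr.2)

theorem IsRDiscrete.exists_isConull_of_ae (hd : 𝒢.IsRDiscrete) {p : G → Prop}
    (h : ∀ᵐ γ ∂𝒢.meas, p γ) : ∃ V, 𝒢.IsConull V ∧ ∀ γ, 𝒢.src γ ∈ V → 𝒢.rng γ ∈ V → p γ := by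
  obtain ⟨V, hV, hn⟩ := hd.exists_isConull_forall_notMem (N := {γ | ¬ p γ}) h
  exact ⟨V, hV, fun γ h1 h2 => not_not.1 (hn γ h1 h2)⟩

end MeasuredGroupoid

/-! ### Pullbacks of representations and invariance of property `T` under similarity -/

namespace MeasuredGroupoid

variable {X G : Type*} [MeasurableSpace X] [StandardBorelSpace X]
  [MeasurableSpace G] [StandardBorelSpace G] {𝒢 : MeasuredGroupoid X G}
  {X' G' : Type*} [MeasurableSpace X'] [StandardBorelSpace X']
  [MeasurableSpace G'] [StandardBorelSpace G'] {𝒢' : MeasuredGroupoid X' G'}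

theorem Representation.op_congr (L : 𝒢.Representation) {γ γ' : G} (e : γ = γ') {x y : X}
    (hs : 𝒢.src γ = x) (hr : 𝒢.rng γ = y) (hs' : 𝒢.src γ' = x) (hr' : 𝒢.rng γ' = y)
    (v : L.bundle.fiber x) : L.op γ x y hs hr v = L.op γ' x y hs' hr' v := by
  subst e
  rfl

theorem Representation.inner_op_fund (L : 𝒢.Representation) (m n : ℕ) (γ : G) {x y : X}
    (hs : 𝒢.src γ = x) (hr : 𝒢.rng γ = y) :
    (inner ℂ (L.bundle.fund m y) (L.op γ x y hs hr (L.bundle.fund n x)) : ℂ) =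
      inner ℂ (L.bundle.fund m (𝒢.rng γ)) (L.op γ _ _ rfl rfl (L.bundle.fund n (𝒢.src γ))) := by
  subst hs hr
  rfl

theorem Representation.coboundary_eq_zero_iff (L : 𝒢.Representation)
    (ξ : ∀ x, L.bundle.fiber x) (γ : G) {x y : X} (hs : 𝒢.src γ = x) (hr : 𝒢.rng γ = y) :
    L.coboundary ξ γ = 0 ↔ L.op γ x y hs hr (ξ x) = ξ y := by
  subst hs hr
  rw [Representation.coboundary, sub_eq_zero, eq_comm]

theorem Representation.norm_coboundary (L : 𝒢.Representation)
    (ξ : ∀ x, L.bundle.fiber x) (γ : G) {x y : X} (hs : 𝒢.src γ = x) (hr : 𝒢.rng γ = y) :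
    ‖L.coboundary ξ γ‖ = ‖ξ y - L.op γ x y hs hr (ξ x)‖ := by
  subst hs hr
  rfl

theorem measurable_unitMap {φ : G → G'} (hφ : Measurable φ) :
    Measurable (𝒢.unitMap 𝒢' φ) :=
  𝒢'.measurable_rng.comp (hφ.comp 𝒢.measurable_one)

theorem IsStrictHomOn.isConull_inter_preimage {φ : G → G'} {U : Set X} {V : Set X'}
    (h : 𝒢.IsStrictHomOn 𝒢' φ U) (hφ : Measurable φ) (hU : 𝒢.IsConull U)
    (hV : 𝒢'.IsConull V) : 𝒢.IsConull (U ∩ 𝒢.unitMap 𝒢' φ ⁻¹' V) := by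
  refine ⟨hU.1.inter (measurable_unitMap hφ hV.1), ?_⟩
  have h0 := h.2.2.2 _ hV.1.compl hV.2
  refine measure_mono_null (t := Uᶜ ∪ (U ∩ 𝒢.unitMap 𝒢' φ ⁻¹' Vᶜ)) ?_
    (measure_union_null hU.2 h0)
  intro x hx
  by_cases hxU : x ∈ U
  · exact Or.inr ⟨hxU, fun hxV => hx ⟨hxU, hxV⟩⟩
  · exact Or.inl hxU

open Classical in
/-- The operators of the pullback of a representation. -/
noncomputable def Representation.pullbackOp (L : 𝒢'.Representation) (φ : G → G')
    (γ : G) (x y : X) :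
    L.bundle.fiber (𝒢.unitMap 𝒢' φ x) →L[ℂ] L.bundle.fiber (𝒢.unitMap 𝒢' φ y) :=
  -- The endpoints match on an inessential reduction; the value `0` elsewhere keeps the family
  -- Borel.
  if h : 𝒢'.src (φ γ) = 𝒢.unitMap 𝒢' φ x ∧ 𝒢'.rng (φ γ) = 𝒢.unitMap 𝒢' φ y then
    L.op (φ γ) _ _ h.1 h.2 else 0

theorem Representation.pullbackOp_apply (L : 𝒢'.Representation) (φ : G → G')
    (γ : G) (x y : X) (hs : 𝒢'.src (φ γ) = 𝒢.unitMap 𝒢' φ x)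
    (hr : 𝒢'.rng (φ γ) = 𝒢.unitMap 𝒢' φ y) :
    L.pullbackOp (𝒢 := 𝒢) φ γ x y = L.op (φ γ) _ _ hs hr :=
  dif_pos ⟨hs, hr⟩

theorem Representation.measurable_pullbackOp (L : 𝒢'.Representation) {φ : G → G'}
    (hφ : Measurable φ) (m n : ℕ) : Measurable fun γ =>
      (inner ℂ (L.bundle.fund m (𝒢.unitMap 𝒢' φ (𝒢.rng γ)))
        (L.pullbackOp (𝒢 := 𝒢) φ γ (𝒢.src γ) (𝒢.rng γ)
          (L.bundle.fund n (𝒢.unitMap 𝒢' φ (𝒢.src γ)))) : ℂ) := by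
  classical
  have hS : MeasurableSet {γ | 𝒢'.src (φ γ) = 𝒢.unitMap 𝒢' φ (𝒢.src γ) ∧
      𝒢'.rng (φ γ) = 𝒢.unitMap 𝒢' φ (𝒢.rng γ)} :=
    (measurableSet_eq_fun (𝒢'.measurable_src.comp hφ)
      ((measurable_unitMap hφ).comp 𝒢.measurable_src)).inter
    (measurableSet_eq_fun (𝒢'.measurable_rng.comp hφ)
      ((measurable_unitMap hφ).comp 𝒢.measurable_rng))
  have : Measurable fun γ => if _ : 𝒢'.src (φ γ) = 𝒢.unitMap 𝒢' φ (𝒢.src γ) ∧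
      𝒢'.rng (φ γ) = 𝒢.unitMap 𝒢' φ (𝒢.rng γ) then _ else _ :=
    Measurable.ite hS ((L.measurable_op m n).comp hφ) (measurable_const (a := (0 : ℂ)))
  convert this using 2 with γ
  split_ifs with h
  · rw [L.pullbackOp_apply φ γ _ _ h.1 h.2, L.inner_op_fund]
    rfl
  · rw [Representation.pullbackOp, dif_neg h]
    simp

/-- The pullback of a representation by a homomorphism. -/
noncomputable def Representation.pullback (L : 𝒢'.Representation) (φ : G → G')
    (hφ : 𝒢.IsHom 𝒢' φ) : 𝒢.Representation where
  bundle := L.bundle.pullback (𝒢.unitMap 𝒢' φ) (measurable_unitMap hφ.1)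
  op γ x y _ _ := L.pullbackOp (𝒢 := 𝒢) φ γ x y
  measurable_op m n := L.measurable_pullbackOp hφ.1 m n
  exists_strict := by
    obtain ⟨hm, U, hU, hstrict⟩ := hφ
    obtain ⟨V, hV, hiso, hone, hmul⟩ := L.exists_strict
    refine ⟨_, hstrict.isConull_inter_preimage hm hU hV, ?_, ?_, ?_⟩
    · rintro γ x y rfl rfl hx hy v
      obtain ⟨h1, h2, -⟩ := hstrict.2.1 γ hx.1 hy.1
      rw [L.pullbackOp_apply φ γ _ _ h1 h2]
      exact hiso _ _ _ h1 h2 hx.2 hy.2 v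
    · intro x hx v
      have e := hstrict.1 x hx.1
      have h1 : 𝒢'.src (φ (𝒢.one x)) = 𝒢.unitMap 𝒢' φ x := by rw [e, 𝒢'.src_one]
      have h2 : 𝒢'.rng (φ (𝒢.one x)) = 𝒢.unitMap 𝒢' φ x := rfl
      rw [L.pullbackOp_apply φ _ _ _ h1 h2]
      exact (L.op_congr e h1 h2 (𝒢'.src_one _) (𝒢'.rng_one _) v).trans (hone _ hx.2 v)
    · rintro γ₁ γ₂ x y z rfl rfl hs₁ rfl hx hy hz v
      obtain ⟨h1, h2, -⟩ := hstrict.2.1 γ₂ hx.1 hy.1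
      obtain ⟨h3, h4, -⟩ := hstrict.2.1 γ₁ (hs₁ ▸ hy.1) hz.1
      rw [hs₁] at h3
      have e := hstrict.2.2.1 γ₁ γ₂ hs₁ hx.1 hy.1 hz.1
      have h5 := h3.trans h2.symm
      have h6 : 𝒢'.src (φ (𝒢.mul γ₁ γ₂)) = 𝒢.unitMap 𝒢' φ (𝒢.src γ₂) := by
        rw [e, 𝒢'.src_mul _ _ h5, h1]
      have h7 : 𝒢'.rng (φ (𝒢.mul γ₁ γ₂)) = 𝒢.unitMap 𝒢' φ (𝒢.rng γ₁) := by
        rw [e, 𝒢'.rng_mul _ _ h5, h4]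
      rw [L.pullbackOp_apply φ γ₂ _ _ h1 h2, L.pullbackOp_apply φ γ₁ _ _ h3 h4,
        L.pullbackOp_apply φ _ _ _ h6 h7, L.op_congr e h6 h7 (e ▸ h6) (e ▸ h7)]
      exact hmul _ _ _ _ _ h1 h2 h3 h4 hx.2 hy.2 hz.2 v

theorem Representation.norm_coboundary_pullback (L : 𝒢'.Representation) {φ : G → G'}
    (hφ : 𝒢.IsHom 𝒢' φ) (η : ∀ x, L.bundle.fiber (𝒢.unitMap 𝒢' φ x)) (γ : G) :
    ‖(L.pullback φ hφ).coboundary η γ‖ =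
      ‖η (𝒢.rng γ) - L.pullbackOp (𝒢 := 𝒢) φ γ (𝒢.src γ) (𝒢.rng γ) (η (𝒢.src γ))‖ :=
  rfl

theorem Representation.HasUnitInvariantSection.of_pullback {L : 𝒢'.Representation} {φ : G → G'}
    {hφ : 𝒢.IsHom 𝒢' φ} (h : (L.pullback φ hφ).HasUnitInvariantSection) :
    ∃ η : ∀ x, L.bundle.fiber (𝒢.unitMap 𝒢' φ x),
      (L.bundle.pullback _ (measurable_unitMap hφ.1)).IsBorelSection η ∧
      (∀ᵐ x ∂𝒢.unitMeas, ‖η x‖ = 1) ∧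
      ∀ᵐ γ ∂𝒢.meas, L.pullbackOp (𝒢 := 𝒢) φ γ (𝒢.src γ) (𝒢.rng γ) (η (𝒢.src γ)) =
        η (𝒢.rng γ) := by
  obtain ⟨η, ⟨h1, h2⟩, h3⟩ := h
  exact ⟨η, h1, h2, h3.mono fun γ h => (sub_eq_zero.1 h).symm⟩

open Classical in
/-- Transport of a section along arrows: given a section `η` over the points `f x` and arrows
`θ x` from `f x` to `x`, the section `x ↦ L (θ x) η x`. -/
noncomputable def Representation.transport (L : 𝒢.Representation) (f : X → X) (θ : X → G)
    (η : ∀ x, L.bundle.fiber (f x)) (x : X) : L.bundle.fiber x :=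
  if h : 𝒢.src (θ x) = f x ∧ 𝒢.rng (θ x) = x then L.op (θ x) _ _ h.1 h.2 (η x) else 0

theorem Representation.isBorelSection_transport (L : 𝒢.Representation) {f : X → X} {θ : X → G}
    (hf : Measurable f) (hθ : Measurable θ) {η : ∀ x, L.bundle.fiber (f x)}
    (hη : (L.bundle.pullback f hf).IsBorelSection η) :
    L.bundle.IsBorelSection (L.transport f θ η) := by
  classical
  rw [HilbertBundle.isBorelSection_iff]
  intro m
  have hS : MeasurableSet {x | 𝒢.src (θ x) = f x ∧ 𝒢.rng (θ x) = x} :=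
    (measurableSet_eq_fun (𝒢.measurable_src.comp hθ) hf).inter
    (measurableSet_eq_fun (𝒢.measurable_rng.comp hθ) measurable_id)
  -- The adjoint moves the operator onto the fundamental section. The coefficients of `u` are
  -- conjugates of those of `L`, so `u` is Borel, and its inner product with `η` is the required
  -- function.
  set u : ∀ x, L.bundle.fiber (f x) := fun x =>
    if h : 𝒢.src (θ x) = f x ∧ 𝒢.rng (θ x) = x then
      ContinuousLinearMap.adjoint (L.op (θ x) _ _ h.1 h.2) (L.bundle.fund m x) else 0 with hu
  have hum : (L.bundle.pullback f hf).IsBorelSection u := by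
    rw [HilbertBundle.isBorelSection_iff]
    intro n
    have : Measurable fun x => if _ : 𝒢.src (θ x) = f x ∧ 𝒢.rng (θ x) = x then _ else _ :=
      Measurable.ite hS ((Complex.continuous_conj.measurable.comp
        (L.measurable_op m n)).comp hθ) (measurable_const (a := (0 : ℂ)))
    convert this using 2 with x
    show inner ℂ (L.bundle.fund n (f x)) (u x) = _
    simp only [hu]
    split_ifs with h
    · rw [ContinuousLinearMap.adjoint_inner_right, ← inner_conj_symm, L.inner_op_fund]
      rfl
    · simp
  have := hum.measurable_inner hη
  convert this using 2 with x
  show _ = inner ℂ (u x) (η x)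
  simp only [hu, Representation.transport]
  split_ifs with h
  · rw [ContinuousLinearMap.adjoint_inner_left]
  · simp

theorem HasPropertyT.of_similarHoms (hd : 𝒢.IsRDiscrete) (hd' : 𝒢'.IsRDiscrete)
    {φ : G → G'} {ψ : G' → G} (hφ : 𝒢.IsHom 𝒢' φ) (hψ : 𝒢'.IsHom 𝒢 ψ)
    (hsim : 𝒢.SimilarHoms 𝒢 (ψ ∘ φ) id) (hT : 𝒢'.HasPropertyT) : 𝒢.HasPropertyT := by
  rintro L ⟨ξ, hξ, hlim⟩
  -- The image of `ψ` may lie in a null set of arrows, so convergence is first secured on every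
  -- arrow of a reduction.
  obtain ⟨V₁, hV₁, hlim⟩ := hd.exists_isConull_of_ae hlim
  obtain ⟨Uψ, hUψ, hsψ⟩ := hψ.2
  obtain ⟨Uφ, hUφ, hsφ⟩ := hφ.2
  obtain ⟨UL, hUL, hiso, -, hmul⟩ := L.exists_strict
  set p := 𝒢'.unitMap 𝒢 ψ with hp
  set q := 𝒢.unitMap 𝒢' φ with hq
  have hpm : Measurable p := measurable_unitMap hψ.1
  have hqm : Measurable q := measurable_unitMap hφ.1
  obtain ⟨η, hηm, hη1, hη0⟩ := Representation.HasUnitInvariantSection.of_pullback <|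
      hT (L.pullback ψ hψ) <| by
    refine ⟨fun n y => ξ n (p y), fun n => ⟨(hξ n).1.pullback hpm, ?_⟩, ?_⟩
    · obtain ⟨V, hV, h1⟩ := exists_isConull_of_ae (hξ n).2
      filter_upwards [(hsψ.isConull_inter_preimage hψ.1 hUψ hV).ae_mem] with y hy
      exact h1 _ hy.2
    · filter_upwards [(hsψ.isConull_inter_preimage hψ.1 hUψ hV₁).ae_src_rng_mem] with γ hγ
      obtain ⟨h1, h2, -⟩ := hsψ.2.1 γ hγ.1.1 hγ.2.1
      refine (hlim (ψ γ) (h1 ▸ hγ.1.2) (h2 ▸ hγ.2.2)).congr fun n => ?_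
      have e := L.norm_coboundary_pullback hψ (fun y => ξ n (p y)) γ
      rw [L.pullbackOp_apply ψ γ _ _ h1 h2] at e
      exact (L.norm_coboundary _ _ h1 h2).trans e.symm
  obtain ⟨V₂, hV₂, hη0⟩ := hd'.exists_isConull_of_ae hη0
  obtain ⟨V₃, hV₃, hη1⟩ := exists_isConull_of_ae hη1
  obtain ⟨U, hU, -, -, θ, hθ, hθU⟩ := hsim
  have hW := (hU.inter hUL).inter (hsφ.isConull_inter_preimage hφ.1 hUφ
    ((hV₂.inter hV₃).inter (hsψ.isConull_inter_preimage hψ.1 hUψ hUL)))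
  set W := (U ∩ UL) ∩ (Uφ ∩ q ⁻¹' ((V₂ ∩ V₃) ∩ (Uψ ∩ p ⁻¹' UL))) with hWdef
  -- Evaluating the similarity at the unit `one x` shows that `θ x` is an arrow from `p (q x)` to
  -- `x`.
  have hθW : ∀ x ∈ W, 𝒢.src (θ x) = p (q x) ∧ 𝒢.rng (θ x) = x := by
    intro x hx
    obtain ⟨h1, h2, -⟩ := hθU (𝒢.one x) (by rw [𝒢.src_one]; exact hx.1.1)
      (by rw [𝒢.rng_one]; exact hx.1.1)
    rw [𝒢.rng_one, Function.comp_apply, hsφ.1 x hx.2.1] at h1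
    rw [id, 𝒢.src_one] at h2
    exact ⟨h1, h2.symm⟩
  set ζ := L.transport (fun x => p (q x)) θ fun x => η (q x) with hζ
  have hζW : ∀ x (hx : x ∈ W),
      ζ x = L.op (θ x) _ _ (hθW x hx).1 (hθW x hx).2 (η (q x)) :=
    fun x hx => dif_pos (hθW x hx)
  refine ⟨ζ, ⟨L.isBorelSection_transport (hpm.comp hqm) hθ (hηm.pullback hqm), ?_⟩, ?_⟩
  · filter_upwards [hW.ae_mem] with x hx
    rw [hζW x hx, hiso _ _ _ _ _ hx.2.2.2.2 hx.1.2]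
    exact hη1 _ hx.2.2.1.2
  · filter_upwards [hW.ae_src_rng_mem] with γ hγ
    rw [L.coboundary_eq_zero_iff _ _ rfl rfl, hζW _ hγ.1, hζW _ hγ.2]
    obtain ⟨s₁, r₁, -⟩ := hsφ.2.1 γ hγ.1.2.1 hγ.2.2.1
    have hs₁ : 𝒢'.src (φ γ) ∈ Uψ := by rw [s₁]; exact hγ.1.2.2.2.1
    have hr₁ : 𝒢'.rng (φ γ) ∈ Uψ := by rw [r₁]; exact hγ.2.2.2.2.1
    obtain ⟨s₂, r₂, -⟩ := hsψ.2.1 (φ γ) hs₁ hr₁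
    have s₃ : 𝒢.src (ψ (φ γ)) = p (q (𝒢.src γ)) := by rw [s₂, s₁]
    have r₃ : 𝒢.rng (ψ (φ γ)) = p (q (𝒢.rng γ)) := by rw [r₂, r₁]
    have hinv := hη0 (φ γ) (by rw [s₁]; exact hγ.1.2.2.1.1) (by rw [r₁]; exact hγ.2.2.2.1.1)
    have hinv' : L.op (ψ (φ γ)) _ _ s₃ r₃ (η (q (𝒢.src γ))) = η (q (𝒢.rng γ)) := by
      rw [s₁, r₁, L.pullbackOp_apply ψ (φ γ) _ _ s₃ r₃] at hinv
      exact hinv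
    obtain ⟨-, -, hcomm⟩ := hθU γ hγ.1.1.1 hγ.2.1.1
    rw [id, Function.comp_apply] at hcomm
    -- Both sides of the invariance equation are `L` of one arrow, factored as `γ · θ (s γ)` and as
    -- `θ (r γ) · ψ (φ γ)`, applied to the same vector.
    have m₁ := hmul γ (θ (𝒢.src γ)) _ _ _ (hθW _ hγ.1).1 (hθW _ hγ.1).2 rfl rfl
      hγ.1.2.2.2.2 hγ.1.1.2 hγ.2.1.2 (η (q (𝒢.src γ)))
    have m₂ := hmul (θ (𝒢.rng γ)) (ψ (φ γ)) _ _ _ s₃ r₃ (hθW _ hγ.2).1 (hθW _ hγ.2).2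
      hγ.1.2.2.2.2 hγ.2.2.2.2.2 hγ.2.1.2 (η (q (𝒢.src γ)))
    rw [← m₁, ← hinv', ← m₂]
    exact L.op_congr hcomm.symm _ _ _ _ _

theorem Similar.hasPropertyT_iff (hd : 𝒢.IsRDiscrete) (hd' : 𝒢'.IsRDiscrete)
    (h : 𝒢.Similar 𝒢') : 𝒢.HasPropertyT ↔ 𝒢'.HasPropertyT := by
  obtain ⟨φ, ψ, hφ, hψ, h₁, h₂⟩ := h
  exact ⟨fun hT => hT.of_similarHoms hd' hd hψ hφ h₁, fun hT => hT.of_similarHoms hd hd' hφ hψ h₂⟩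

end MeasuredGroupoid

/-! ### Almost invariant vectors of groups with property `T` -/

section group

/-- A multiplicative family of linear isometries is a unitary representation. -/
def unitaryRepOfLinearIsometry {Γ E : Type*} [Group Γ] [NormedAddCommGroup E]
    [InnerProductSpace ℂ E] (U : Γ → E →ₗᵢ[ℂ] E) (one : ∀ v, U 1 v = v)
    (mul : ∀ g h v, U (g * h) v = U g (U h v)) : Γ →* (E ≃ₗᵢ[ℂ] E) where
  toFun g :=
    { toLinearEquiv :=
        { (U g).toLinearMap with
          invFun := U g⁻¹
          left_inv := fun v => by
            show U g⁻¹ (U g v) = v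
            rw [← mul, inv_mul_cancel, one]
          right_inv := fun v => by
            show U g (U g⁻¹ v) = v
            rw [← mul, mul_inv_cancel, one] }
      norm_map' := (U g).norm_map }
  map_one' := LinearIsometryEquiv.ext fun v => one v
  map_mul' g h := LinearIsometryEquiv.ext fun v => mul g h v

/-- The invariant vectors of a unitary representation. -/
def invariantVectors {Γ E : Type*} [Group Γ] [NormedAddCommGroup E]
    [InnerProductSpace ℂ E] (π : Γ →* (E ≃ₗᵢ[ℂ] E)) : Submodule ℂ E where
  carrier := {v | ∀ g, π g v = v}
  add_mem' hv hw g := by rw [map_add, hv g, hw g]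
  zero_mem' g := map_zero _
  smul_mem' c v hv g := by rw [map_smul, hv g]

theorem isClosed_invariantVectors {Γ E : Type*} [Group Γ] [NormedAddCommGroup E]
    [InnerProductSpace ℂ E] (π : Γ →* (E ≃ₗᵢ[ℂ] E)) :
    IsClosed (invariantVectors π : Set E) := by
  have : (invariantVectors π : Set E) = ⋂ g, {v | π g v = v} := by
    ext v
    simp [invariantVectors]
  rw [this]
  exact isClosed_iInter fun g => isClosed_eq (π g).continuous continuous_id

theorem map_mem_orthogonal_invariantVectors {Γ E : Type*} [Group Γ] [NormedAddCommGroup E]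
    [InnerProductSpace ℂ E] (π : Γ →* (E ≃ₗᵢ[ℂ] E)) (g : Γ) {v : E}
    (hv : v ∈ (invariantVectors π)ᗮ) : π g v ∈ (invariantVectors π)ᗮ := by
  rw [Submodule.mem_orthogonal] at *
  intro u hu
  rw [← hu g, LinearIsometryEquiv.inner_map_map]
  exact hv u hu

/-- For a group with property `T`, almost invariant vectors are close to invariant vectors. -/
theorem GroupHasPropertyT.exists_invariant_tendsto {Γ : Type*} [Group Γ]
    (hT : GroupHasPropertyT Γ) {H : Type} [NormedAddCommGroup H] [InnerProductSpace ℂ H]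
    [CompleteSpace H] [TopologicalSpace.SeparableSpace H] (π : Γ →* (H ≃ₗᵢ[ℂ] H)) (v : ℕ → H)
    (hv : ∀ g, Tendsto (fun n => π g (v n) - v n) atTop (𝓝 0)) :
    ∃ u : ℕ → H, (∀ n g, π g (u n) = u n) ∧ Tendsto (fun n => u n - v n) atTop (𝓝 0) := by
  set M := invariantVectors π with hM
  have : CompleteSpace M := (isClosed_invariantVectors π).completeSpace_coe
  have : SecondCountableTopology H := UniformSpace.secondCountable_of_separable H
  set ρ : Γ →* (Mᗮ ≃ₗᵢ[ℂ] Mᗮ) := unitaryRepOfLinearIsometry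
    (fun g => ⟨(π g).toLinearEquiv.toLinearMap.restrict
      fun v hv => map_mem_orthogonal_invariantVectors π g hv, fun v => (π g).norm_map v⟩)
    (fun v => Subtype.ext (by simp)) (fun g h v => Subtype.ext (by
      show π (g * h) v = π g (π h v)
      rw [map_mul]; rfl)) with hρ
  have hρ' : ∀ g (k : Mᗮ), ((ρ g k : Mᗮ) : H) = π g k := fun g k => rfl
  -- An invariant vector in `Mᗮ` is orthogonal to itself. Property `T` of the restriction to `Mᗮ`
  -- then gives a spectral gap `(Q, ε)`.
  have hno : ¬ ∃ k : Mᗮ, ‖k‖ = 1 ∧ ∀ g, ρ g k = k := by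
    rintro ⟨k, hk, hinv⟩
    have hkM : (k : H) ∈ M := fun g => by rw [← hρ', hinv g]
    have : (inner ℂ (k : H) (k : H) : ℂ) = 0 := (Submodule.mem_orthogonal _ _).1 k.2 _ hkM
    rw [inner_self_eq_zero] at this
    rw [Submodule.coe_norm, this, norm_zero] at hk
    exact zero_ne_one hk
  have hgap := mt (hT Mᗮ ρ) hno
  push Not at hgap
  obtain ⟨Q, ε, hε, hQ⟩ := hgap
  have hbound : ∀ k : Mᗮ, ε * ‖k‖ ≤ ∑ g ∈ Q, ‖π g k - k‖ := by
    intro k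
    by_cases hk : k = 0
    · subst hk
      simp
    have hk' : 0 < ‖k‖ := norm_pos_iff.2 hk
    obtain ⟨g, hg, hge⟩ := hQ ((‖k‖⁻¹ : ℂ) • k) (by
      rw [norm_smul]; simp [hk])
    have e : ρ g ((‖k‖⁻¹ : ℂ) • k) - (‖k‖⁻¹ : ℂ) • k = (‖k‖⁻¹ : ℂ) • (ρ g k - k) := by
      rw [map_smul, smul_sub]
    rw [e, norm_smul] at hge
    have h1 : ‖(‖k‖⁻¹ : ℂ)‖ = ‖k‖⁻¹ := by simp
    rw [h1, le_inv_mul_iff₀ hk', mul_comm] at hge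
    refine hge.trans ?_
    exact Finset.single_le_sum (f := fun g => ‖π g k - k‖) (fun _ _ => norm_nonneg _) hg
  -- The projections to `M` work: `π g` displaces `v n` and its component in `Mᗮ` by the same
  -- vector, and the gap bounds that component.
  refine ⟨fun n => M.starProjection (v n), fun n g => ?_, ?_⟩
  · exact (M.starProjection_apply_mem (v n) : _) g
  · have hk : ∀ n, v n - M.starProjection (v n) ∈ Mᗮ := fun n =>
      M.sub_starProjection_mem_orthogonal (v n)
    have hle : ∀ n, ‖M.starProjection (v n) - v n‖ ≤ ε⁻¹ * ∑ g ∈ Q, ‖π g (v n) - v n‖ := by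
      intro n
      have h := hbound ⟨_, hk n⟩
      rw [le_inv_mul_iff₀ hε, norm_sub_rev]
      refine h.trans (le_of_eq (Finset.sum_congr rfl fun g _ => ?_))
      have hp : π g (M.starProjection (v n)) = M.starProjection (v n) :=
        (M.starProjection_apply_mem (v n) : _) g
      show ‖π g (v n - M.starProjection (v n)) - (v n - M.starProjection (v n))‖ = _
      rw [map_sub, hp]
      congr 1
      abel
    refine squeeze_zero_norm hle ?_
    have : Tendsto (fun n => ε⁻¹ * ∑ g ∈ Q, ‖π g (v n) - v n‖) atTop
        (𝓝 (ε⁻¹ * ∑ g ∈ Q, 0)) :=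
      (tendsto_finsetSum _ fun g _ => by simpa using (hv g).norm).const_mul _
    simpa using this

/-- A countable group has almost invariant unit vectors iff it has a sequence of those. -/
theorem exists_seq_almost_invariant {Γ H : Type*} [Group Γ] [Countable Γ] [NormedAddCommGroup H]
    [InnerProductSpace ℂ H] (π : Γ →* (H ≃ₗᵢ[ℂ] H))
    (h : ∀ (Q : Finset Γ) (ε : ℝ), 0 < ε → ∃ v : H, ‖v‖ = 1 ∧ ∀ g ∈ Q, ‖π g v - v‖ < ε) :
    ∃ v : ℕ → H, (∀ n, ‖v n‖ = 1) ∧ ∀ g, Tendsto (fun n => π g (v n) - v n) atTop (𝓝 0) := by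
  classical
  obtain ⟨e, he⟩ := exists_surjective_nat Γ
  choose v hv1 hv using fun n : ℕ =>
    h ((Finset.range (n + 1)).image e) (1 / ((n : ℝ) + 1)) (by positivity)
  refine ⟨v, hv1, fun g => ?_⟩
  obtain ⟨k, rfl⟩ := he g
  refine squeeze_zero_norm' ?_ tendsto_one_div_add_atTop_nhds_zero_nat
  filter_upwards [eventually_ge_atTop k] with n hn
  exact (hv n _ (Finset.mem_image_of_mem e (Finset.mem_range.2 (by omega)))).le

end group

/-! ### Functions invariant almost everywhere and fundamental domains -/

section invariant

open scoped Pointwise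

variable {Γ Λ Ω : Type*} [Group Γ] [Group Λ] [MeasurableSpace Ω] [MulAction Γ Ω] [MulAction Λ Ω]
  {m : Measure Ω}

/-- The points where `F` is constant along the whole orbit form an invariant set, conull by
countability of `Γ`; off it, `F` is replaced by `0`. -/
theorem exists_invariant_ae_eq [Countable Γ] {E : Type*} [Zero E] {F : Ω → E}
    (hF : ∀ g : Γ, (fun ω => F (g • ω)) =ᵐ[m] F) :
    ∃ F' : Ω → E, F' =ᵐ[m] F ∧ ∀ (g : Γ) ω, F' (g • ω) = F' ω := by
  classical
  refine ⟨fun ω => if ∀ g : Γ, F (g • ω) = F ω then F ω else 0, ?_, fun g ω => ?_⟩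
  · filter_upwards [ae_all_iff.2 hF] with ω hω
    exact if_pos hω
  · have h : (∀ g' : Γ, F (g' • g • ω) = F (g • ω)) ↔ ∀ g' : Γ, F (g' • ω) = F ω := by
      constructor
      · intro h g'
        have h1 := h (g' * g⁻¹)
        have h2 := h g⁻¹
        rw [smul_smul, inv_mul_cancel_right] at h1
        rw [inv_smul_smul] at h2
        rw [h1, h2]
      · intro h g'
        rw [smul_smul, h, h]
    simp only [h]
    split_ifs with h0
    · exact h0 g
    · rfl

variable [MeasurableConstSMul Γ Ω] [SMulInvariantMeasure Γ Ω m] [MeasurableConstSMul Λ Ω]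
  [SMulInvariantMeasure Λ Ω m]

theorem MeasureTheory.IsFundamentalDomain.setIntegral_eq_of_ae [Countable Γ] {E : Type*}
    [NormedAddCommGroup E] [NormedSpace ℝ E] {s t : Set Ω} (hs : IsFundamentalDomain Γ s m)
    (ht : IsFundamentalDomain Γ t m) {F : Ω → E} (hF : ∀ g : Γ, (fun ω => F (g • ω)) =ᵐ[m] F) :
    ∫ ω in s, F ω ∂m = ∫ ω in t, F ω ∂m := by
  obtain ⟨F', hF', hinv⟩ := exists_invariant_ae_eq hF
  rw [← integral_congr_ae (ae_restrict_of_ae hF'), ← integral_congr_ae (ae_restrict_of_ae hF')]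
  exact hs.setIntegral_eq ht hinv

/-- The equivariant map to the group given by a fundamental domain: almost every point `ω` lies in the translate
by `a ω`. -/
theorem MeasureTheory.IsFundamentalDomain.exists_equivariant_map [Countable Γ] {A : Set Ω}
    (hA : IsFundamentalDomain Γ A m) :
    ∃ a : Ω → Γ, (∀ g, NullMeasurableSet {ω | a ω = g} m) ∧
      ∀ g : Γ, ∀ᵐ ω ∂m, a (g • ω) = g * a ω := by
  classical
  have hdisj : ∀ᵐ ω ∂m, ∀ g g' : Γ, ω ∈ g • A → ω ∈ g' • A → g = g' := by
    rw [ae_all_iff]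
    intro g
    rw [ae_all_iff]
    intro g'
    by_cases h : g = g'
    · exact Eventually.of_forall fun _ _ _ => h
    · filter_upwards [measure_eq_zero_iff_ae_notMem.1 (hA.aedisjoint h)] with ω hω h1 h2
      exact absurd ⟨h1, h2⟩ hω
  set a : Ω → Γ := fun ω => if h : ∃ g : Γ, ω ∈ g • A then h.choose else 1 with ha
  have hmem : ∀ᵐ ω ∂m, ω ∈ a ω • A := by
    filter_upwards [hA.ae_covers] with ω hω
    have h : ∃ g : Γ, ω ∈ g • A := by
      obtain ⟨g, hg⟩ := hω
      exact ⟨g⁻¹, Set.mem_inv_smul_set_iff.2 hg⟩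
    simp only [ha, dif_pos h]
    exact h.choose_spec
  refine ⟨a, fun g => ?_, fun g => ?_⟩
  · refine (hA.nullMeasurableSet_smul g).congr ?_
    filter_upwards [hdisj, hmem] with ω h1 h2
    refine propext ⟨fun h => h1 _ _ h2 h, fun h => ?_⟩
    have h' : a ω = g := h
    exact h' ▸ h2
  · have hq := (measurePreserving_smul g m).quasiMeasurePreserving
    filter_upwards [hmem, hq.ae hdisj, hq.ae hmem] with ω h1 h2 h3
    refine h2 _ _ h3 ?_
    rw [mul_smul]
    exact Set.smul_mem_smul_set h1

/-- The properties of a measure on which induced representations are built. -/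
structure IsInducingMeasure (Γ Λ : Type*) [Group Γ] [Group Λ] [MulAction Γ Ω] [MulAction Λ Ω]
    (ν : Measure Ω) : Prop where
  qmp_left : ∀ g : Γ, Measure.QuasiMeasurePreserving (fun ω : Ω => g • ω) ν ν
  qmp_right : ∀ h : Λ, Measure.QuasiMeasurePreserving (fun ω : Ω => h • ω) ν ν
  lintegral_smul : ∀ F : Ω → ENNReal, (∀ g : Γ, (fun ω => F (g • ω)) =ᵐ[ν] F) →
    ∀ h : Λ, ∫⁻ ω, F (h • ω) ∂ν = ∫⁻ ω, F ω ∂ν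

/-- The measure `m` may be infinite, so the translates of `A` are weighted by a summable positive
family. The integral of a `Γ`-invariant function is then a constant times its `m`-integral over `A`.
As `Λ` carries `A` to another `Γ`-fundamental domain, it preserves these integrals, although `ν`
itself need not be invariant. -/
theorem MeasureTheory.IsFundamentalDomain.exists_isInducingMeasure [Countable Γ]
    [SMulCommClass Λ Γ Ω] {A : Set Ω} (hA : IsFundamentalDomain Γ A m) (hfin : m A < ⊤) :
    ∃ ν : Measure Ω, IsFiniteMeasure ν ∧ ν ≪ m ∧ m ≪ ν ∧ IsInducingMeasure Γ Λ ν := by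
  obtain ⟨c, hc0, hc1⟩ := ENNReal.exists_pos_sum_of_countable' one_ne_zero Γ
  set ν : Measure Ω := Measure.sum fun g : Γ => c g • m.restrict (g • A) with hν
  have hint : ∀ F : Ω → ENNReal, (∀ (g : Γ) ω, F (g • ω) = F ω) →
      ∫⁻ ω, F ω ∂ν = (∑' g, c g) * ∫⁻ ω in A, F ω ∂m := by
    intro F hF
    rw [hν, lintegral_sum_measure, ← ENNReal.tsum_mul_right]
    congr 1
    funext g
    rw [lintegral_smul_measure, (hA.smul g).setLIntegral_eq hA F hF, smul_eq_mul]
  have hac : ν ≪ m := by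
    refine Measure.AbsolutelyContinuous.mk fun s _ hs => ?_
    rw [hν, Measure.sum_apply_eq_zero]
    intro g
    rw [Measure.smul_apply, Measure.absolutelyContinuous_of_le Measure.restrict_le_self hs,
      smul_zero]
  have hac' : m ≪ ν := by
    refine Measure.AbsolutelyContinuous.mk fun s hsm hs => ?_
    rw [hν, Measure.sum_apply_eq_zero] at hs
    refine measure_mono_null (t := (⋃ g : Γ, s ∩ g • A) ∪ {ω | ¬ ∃ g : Γ, g • ω ∈ A}) ?_
      (measure_union_null (measure_iUnion_null fun g => ?_) hA.ae_covers)
    · intro ω hω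
      by_cases h : ∃ g : Γ, g • ω ∈ A
      · obtain ⟨g, hg⟩ := h
        exact Or.inl (Set.mem_iUnion.2 ⟨g⁻¹, hω, Set.mem_inv_smul_set_iff.2 hg⟩)
      · exact Or.inr h
    · have := hs g
      rw [Measure.smul_apply, smul_eq_mul, mul_eq_zero, Measure.restrict_apply hsm] at this
      exact this.resolve_left (hc0 g).ne'
  refine ⟨ν, ⟨?_⟩, hac, hac', fun g => ⟨measurable_const_smul g, ?_⟩,
    fun h => ⟨measurable_const_smul h, ?_⟩, fun F hF h => ?_⟩
  · have := hint (fun _ => 1) fun _ _ => rfl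
    rw [lintegral_one, setLIntegral_one] at this
    rw [this]
    exact ENNReal.mul_lt_top (hc1.trans ENNReal.one_lt_top) hfin
  · exact (hac.map (measurable_const_smul g)).trans
      ((measurePreserving_smul g m).quasiMeasurePreserving.absolutelyContinuous.trans hac')
  · exact (hac.map (measurable_const_smul h)).trans
      ((measurePreserving_smul h m).quasiMeasurePreserving.absolutelyContinuous.trans hac')
  · obtain ⟨F', hF', hinv⟩ := exists_invariant_ae_eq fun g => hac'.ae_le (hF g)
    have hFh : (fun ω => F' (h • ω)) =ᵐ[m] fun ω => F (h • ω) :=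
      (measurePreserving_smul h m).quasiMeasurePreserving.ae_eq_comp hF'
    rw [← lintegral_congr_ae (hac.ae_le hFh), ← lintegral_congr_ae (hac.ae_le hF'),
      hint F' hinv, hint (fun ω => F' (h • ω)) fun g ω => by rw [smul_comm, hinv]]
    congr 1
    rw [(hA.setLIntegral_eq (hA.smul_of_comm h) F' hinv),
      ← (measurePreserving_smul h m).setLIntegral_comp_preimage_emb
        (measurableEmbedding_const_smul h) F' (h • A), Set.preimage_smul, inv_smul_smul]

end invariant

/-! ### Induced representations -/

section induced

variable {Γ Λ Ω : Type*} [Group Γ] [Group Λ] [MeasurableSpace Ω] [MulAction Γ Ω] [MulAction Λ Ω]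
  {ν : Measure Ω} {H : Type*} [NormedAddCommGroup H] [InnerProductSpace ℂ H]

/-- The space of square integrable equivariant maps into a representation. -/
noncomputable def equivariantLp (hν : IsInducingMeasure Γ Λ ν) (π : Γ →* (H ≃ₗᵢ[ℂ] H)) :
    Submodule ℂ (Lp H 2 ν) where
  carrier := {f | ∀ g : Γ, (fun ω => f (g • ω)) =ᵐ[ν] fun ω => π g (f ω)}
  add_mem' {f f'} hf hf' g := by
    have h := Lp.coeFn_add f f'
    filter_upwards [hf g, hf' g, h, (hν.qmp_left g).ae h] with ω h1 h2 h3 h4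
    rw [h3, h4, Pi.add_apply, Pi.add_apply, h1, h2, map_add]
  zero_mem' g := by
    have h := Lp.coeFn_zero H 2 ν
    filter_upwards [h, (hν.qmp_left g).ae h] with ω h1 h2
    rw [h1, h2, Pi.zero_apply, Pi.zero_apply, map_zero]
  smul_mem' c f hf g := by
    have h := Lp.coeFn_smul c f
    filter_upwards [hf g, h, (hν.qmp_left g).ae h] with ω h1 h2 h3
    rw [h2, h3, Pi.smul_apply, Pi.smul_apply, h1, map_smul]

theorem isClosed_equivariantLp (hν : IsInducingMeasure Γ Λ ν) (π : Γ →* (H ≃ₗᵢ[ℂ] H)) :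
    IsClosed (equivariantLp hν π : Set (Lp H 2 ν)) := by
  refine IsSeqClosed.isClosed fun f f₀ hf hlim g => ?_
  have h1 : TendstoInMeasure ν (fun n => (f n : Ω → H)) atTop f₀ :=
    tendstoInMeasure_of_tendsto_Lp hlim
  obtain ⟨ns, -, hns⟩ := h1.exists_seq_tendsto_ae
  filter_upwards [hns, (hν.qmp_left g).ae hns, ae_all_iff.2 fun k => hf (ns k) g] with ω h2 h3 h4
  refine tendsto_nhds_unique h3 ?_
  simp only [h4]
  exact ((π g).continuous.tendsto _).comp h2

variable {hν : IsInducingMeasure Γ Λ ν} {π : Γ →* (H ≃ₗᵢ[ℂ] H)}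

/-- Since `π` is unitary, `‖f‖ ^ 2` is `Γ`-invariant almost everywhere, and on such functions
`lintegral_smul` applies. -/
theorem eLpNorm_comp_smul_of_mem_equivariantLp {f : Lp H 2 ν} (hf : f ∈ equivariantLp hν π)
    (h : Λ) : eLpNorm (fun ω => f (h • ω)) 2 ν = eLpNorm f 2 ν := by
  simp only [eLpNorm_eq_lintegral_rpow_enorm_toReal (p := 2) two_ne_zero ENNReal.ofNat_ne_top]
  congr 1
  refine hν.lintegral_smul (fun ω => ‖f ω‖ₑ ^ (2 : ENNReal).toReal) (fun g => ?_) h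
  filter_upwards [hf g] with ω hω
  rw [hω, ← ofReal_norm, (π g).norm_map, ofReal_norm]

theorem memLp_comp_smul_of_mem_equivariantLp {f : Lp H 2 ν} (hf : f ∈ equivariantLp hν π)
    (h : Λ) : MemLp (fun ω => f (h • ω)) 2 ν :=
  ⟨(Lp.aestronglyMeasurable f).comp_quasiMeasurePreserving (hν.qmp_right h), by
    rw [eLpNorm_comp_smul_of_mem_equivariantLp hf]; exact Lp.eLpNorm_lt_top f⟩

/-- Translation of an equivariant map by a group element. -/
noncomputable def translateLp (h : Λ) (f : equivariantLp hν π) : Lp H 2 ν :=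
  (memLp_comp_smul_of_mem_equivariantLp f.2 h⁻¹).toLp

theorem coeFn_translateLp (h : Λ) (f : equivariantLp hν π) :
    translateLp h f =ᵐ[ν] fun ω => (f : Lp H 2 ν) (h⁻¹ • ω) :=
  MemLp.coeFn_toLp _

theorem translateLp_mem [SMulCommClass Λ Γ Ω] (h : Λ) (f : equivariantLp hν π) :
    translateLp h f ∈ equivariantLp hν π := by
  intro g
  have h1 := coeFn_translateLp h f
  filter_upwards [h1, (hν.qmp_left g).ae h1, (hν.qmp_right h⁻¹).ae (f.2 g)] with ω h2 h3 h4
  rw [h2, h3, smul_comm, h4]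

/-- The unitary representation induced from `Γ` to `Λ`. -/
noncomputable def inducedRep [SMulCommClass Λ Γ Ω] (hν : IsInducingMeasure Γ Λ ν)
    (π : Γ →* (H ≃ₗᵢ[ℂ] H)) : Λ →* (equivariantLp hν π ≃ₗᵢ[ℂ] equivariantLp hν π) :=
  unitaryRepOfLinearIsometry
    (fun h =>
      { toFun := fun f => ⟨translateLp h f, translateLp_mem h f⟩
        map_add' := fun f f' => by
          refine Subtype.ext (Lp.ext ?_)
          have h1 := Lp.coeFn_add (f : Lp H 2 ν) f'
          have h2 := Lp.coeFn_add (translateLp h f) (translateLp h f')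
          filter_upwards [coeFn_translateLp h f, coeFn_translateLp h f',
            coeFn_translateLp h (f + f'), (hν.qmp_right h⁻¹).ae h1, h2] with ω h3 h4 h5 h6 h7
          show translateLp h (f + f') ω = (translateLp h f + translateLp h f') ω
          rw [h5, h7, Pi.add_apply, h3, h4]
          exact h6
        map_smul' := fun c f => by
          refine Subtype.ext (Lp.ext ?_)
          have h1 := Lp.coeFn_smul c (f : Lp H 2 ν)
          have h2 := Lp.coeFn_smul c (translateLp h f)
          filter_upwards [coeFn_translateLp h f, coeFn_translateLp h (c • f),
            (hν.qmp_right h⁻¹).ae h1, h2] with ω h3 h4 h5 h6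
          show translateLp h (c • f) ω = (c • translateLp h f) ω
          rw [h4, h6, Pi.smul_apply, h3]
          exact h5
        norm_map' := fun f => by
          show ‖translateLp h f‖ = ‖(f : Lp H 2 ν)‖
          rw [translateLp, Lp.norm_toLp, eLpNorm_comp_smul_of_mem_equivariantLp f.2, Lp.norm_def] })
    (fun f => Subtype.ext <| Lp.ext <| by
      filter_upwards [coeFn_translateLp 1 f] with ω h1
      show translateLp 1 f ω = _
      rw [h1, inv_one, one_smul])
    (fun h h' f => Subtype.ext <| Lp.ext <| by
      have h1 := coeFn_translateLp h' f
      filter_upwards [coeFn_translateLp (h * h') f,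
        coeFn_translateLp h ⟨translateLp h' f, translateLp_mem h' f⟩,
        (hν.qmp_right h⁻¹).ae h1] with ω h2 h3 h4
      show translateLp (h * h') f ω = translateLp h ⟨translateLp h' f, translateLp_mem h' f⟩ ω
      rw [h2, h3, h4, smul_smul, mul_inv_rev])

theorem coeFn_inducedRep [SMulCommClass Λ Γ Ω] (h : Λ) (f : equivariantLp hν π) :
    ((inducedRep hν π h f : equivariantLp hν π) : Lp H 2 ν) =ᵐ[ν]
      fun ω => (f : Lp H 2 ν) (h⁻¹ • ω) :=
  coeFn_translateLp h f

end induced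

/-! ### Invariance of property `T` under measure equivalence -/

theorem tendsto_eLpNorm_two_zero_of_bounded {Ω H : Type*} [MeasurableSpace Ω] {ν : Measure Ω}
    [IsFiniteMeasure ν] [NormedAddCommGroup H] {f : ℕ → Ω → H} {C : ℝ}
    (hf : ∀ n, AEStronglyMeasurable (f n) ν) (hC : ∀ n ω, ‖f n ω‖ ≤ C)
    (hlim : ∀ ω, Tendsto (fun n => f n ω) atTop (𝓝 0)) :
    Tendsto (fun n => eLpNorm (f n) 2 ν) atTop (𝓝 0) := by
  simp only [eLpNorm_eq_lintegral_rpow_enorm_toReal (p := 2) two_ne_zero ENNReal.ofNat_ne_top,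
    ENNReal.toReal_ofNat]
  have h1 : Tendsto (fun n => ∫⁻ ω, ‖f n ω‖ₑ ^ (2 : ℝ) ∂ν) atTop (𝓝 (∫⁻ _, 0 ∂ν)) := by
    refine tendsto_lintegral_of_dominated_convergence' (fun _ => ENNReal.ofReal C ^ (2 : ℝ))
      (fun n => (hf n).enorm.pow_const _) (fun n => Eventually.of_forall fun ω => ?_) ?_
      (Eventually.of_forall fun ω => ?_)
    · refine ENNReal.rpow_le_rpow ?_ zero_le_two
      rw [← ofReal_norm]
      exact ENNReal.ofReal_le_ofReal (hC n ω)
    · rw [lintegral_const]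
      exact ENNReal.mul_ne_top (ENNReal.rpow_ne_top_of_nonneg zero_le_two ENNReal.ofReal_ne_top)
        (measure_ne_top _ _)
    · have h2 : Tendsto (fun n => ‖f n ω‖ₑ) atTop (𝓝 0) := by
        simpa using (hlim ω).enorm
      have := (ENNReal.continuous_rpow_const (y := 2)).tendsto 0 |>.comp h2
      simpa [Function.comp_def] using this
  have h2 := (ENNReal.continuous_rpow_const (y := (1 / 2 : ℝ))).tendsto _ |>.comp h1
  simpa [Function.comp_def] using h2

section commuting

open scoped Pointwise

variable {Γ Λ Ω H : Type*} [Group Γ] [Group Λ] [Countable Λ] [MeasurableSpace Ω] [MulAction Γ Ω]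
  [MulAction Λ Ω] {m : Measure Ω} [MeasurableConstSMul Γ Ω] [SMulInvariantMeasure Γ Ω m]
  [MeasurableConstSMul Λ Ω] [SMulInvariantMeasure Λ Ω m] [SMulCommClass Γ Λ Ω]
  [NormedAddCommGroup H] [InnerProductSpace ℂ H]

/-- The integral of an equivariant map over a fundamental domain of a commuting group that leaves
the map invariant is an invariant vector. -/
theorem MeasureTheory.IsFundamentalDomain.map_setIntegral_eq {B : Set Ω}
    (hB : IsFundamentalDomain Λ B m) (π : Γ →* (H ≃ₗᵢ[ℂ] H)) {F : Ω → H}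
    (hΓ : ∀ g : Γ, (fun ω => F (g • ω)) =ᵐ[m] fun ω => π g (F ω))
    (hΛ : ∀ h : Λ, (fun ω => F (h • ω)) =ᵐ[m] F) (g : Γ) :
    π g (∫ ω in B, F ω ∂m) = ∫ ω in B, F ω ∂m := by
  have h1 : π g (∫ ω in B, F ω ∂m) = ∫ ω in B, π g (F ω) ∂m :=
    ((π g).toContinuousLinearEquiv.integral_comp_comm F).symm
  -- The actions commute, so `g • B` is again a `Λ`-fundamental domain and carries the same integral
  -- of `F`.
  rw [h1, ← integral_congr_ae (ae_restrict_of_ae (hΓ g)),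
    hB.setIntegral_eq_of_ae (hB.smul_of_comm g) hΛ,
    ← (measurePreserving_smul g m).setIntegral_preimage_emb
      (measurableEmbedding_const_smul g) F, Set.preimage_smul, inv_smul_smul]

end commuting

/-- Truncation of a vector. -/
noncomputable def truncateVec {H : Type*} [NormedAddCommGroup H] (C : ℝ) (v : H) : H :=
  open Classical in if ‖v‖ ≤ C then v else 0

/-- A vector longer than `2` is at distance more than `1` from the unit vector `v`, while its
replacement `0` is at distance exactly `1`. -/
theorem norm_truncateVec_sub_le {H : Type*} [NormedAddCommGroup H] (w : H) {v : H}
    (hv : ‖v‖ = 1) : ‖truncateVec 2 w - v‖ ≤ ‖w - v‖ := by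
  unfold truncateVec
  split_ifs with h
  · exact le_rfl
  · have := norm_sub_norm_le w v
    rw [zero_sub, norm_neg]
    linarith [not_le.1 h]

theorem norm_truncateVec_le {H : Type*} [NormedAddCommGroup H] (w : H) :
    ‖truncateVec 2 w‖ ≤ 2 := by
  unfold truncateVec
  split_ifs with h
  · exact h
  · simp

theorem map_truncateVec {H : Type*} [NormedAddCommGroup H] [InnerProductSpace ℂ H]
    (e : H ≃ₗᵢ[ℂ] H) (w : H) : truncateVec 2 (e w) = e (truncateVec 2 w) := by
  unfold truncateVec
  rw [e.norm_map]
  split_ifs <;> simp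

theorem MeasureTheory.StronglyMeasurable.truncateVec {Ω H : Type*} [MeasurableSpace Ω]
    [NormedAddCommGroup H] {F : Ω → H} (hF : StronglyMeasurable F) :
    StronglyMeasurable fun ω => truncateVec 2 (F ω) := by
  classical
  have hs : MeasurableSet {ω | ‖F ω‖ ≤ 2} := hF.norm.measurableSet_le stronglyMeasurable_const
  have := hF.indicator hs
  convert this using 1
  funext ω
  simp [_root_.truncateVec, Set.indicator]

theorem GroupHasPropertyT.of_measureEquivalent {Γ Λ : Type*} [Group Γ] [Countable Γ] [Group Λ]
    [Countable Λ] (h : MeasureEquivalent Γ Λ) (hT : GroupHasPropertyT Λ) :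
    GroupHasPropertyT Γ := by
  obtain ⟨Ω, _, _, _, _, m, hm, hcomm, hpΓ, hpΛ, ⟨A, hA, hAfin⟩, B, hB, hBfin⟩ := h
  have : MeasurableConstSMul Γ Ω := ⟨fun g => (hpΓ g).measurable⟩
  have : MeasurableConstSMul Λ Ω := ⟨fun g => (hpΛ g).measurable⟩
  have : SMulInvariantMeasure Γ Ω m :=
    ⟨fun g s hs => (hpΓ g).measure_preimage hs.nullMeasurableSet⟩
  have : SMulInvariantMeasure Λ Ω m :=
    ⟨fun g s hs => (hpΛ g).measure_preimage hs.nullMeasurableSet⟩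
  have : SMulCommClass Λ Γ Ω := SMulCommClass.symm Γ Λ Ω
  obtain ⟨ν, hνfin, hνm, hmν, hν⟩ := hA.exists_isInducingMeasure (Λ := Λ) hAfin
  obtain ⟨a, ham, ha⟩ := hA.exists_equivariant_map
  intro H _ _ _ _ π hπ
  borelize H
  have : SecondCountableTopology H := UniformSpace.secondCountable_of_separable H
  obtain ⟨v, hv1, hv⟩ := exists_seq_almost_invariant π hπ
  set f : ℕ → Ω → H := fun n ω => π (a ω) (v n) with hf
  have hfm : ∀ n, AEStronglyMeasurable (f n) ν := by
    intro n
    refine AEStronglyMeasurable.mono_ac hνm (AEMeasurable.aestronglyMeasurable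
      (NullMeasurable.aemeasurable fun s _ => ?_))
    have : f n ⁻¹' s = ⋃ (g : Γ) (_ : π g (v n) ∈ s), {ω | a ω = g} := by
      ext ω
      simp [hf]
    rw [this]
    exact NullMeasurableSet.iUnion fun g => NullMeasurableSet.iUnion fun _ => ham g
  have hfnorm : ∀ n ω, ‖f n ω‖ = 1 := fun n ω => by rw [hf, (π (a ω)).norm_map, hv1]
  have hfL : ∀ n, MemLp (f n) 2 ν := fun n =>
    MemLp.of_bound (hfm n) 1 (Eventually.of_forall fun ω => (hfnorm n ω).le)
  have hfE : ∀ n, (hfL n).toLp ∈ equivariantLp hν π := by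
    intro n g
    have h1 := (hfL n).coeFn_toLp
    filter_upwards [h1, (hν.qmp_left g).ae h1, hνm.ae_le (ha g)] with ω h2 h3 h4
    rw [h2, h3, hf]
    simp only [h4, map_mul]
    rfl
  have hE : IsClosed (equivariantLp hν π : Set (Lp H 2 ν)) := isClosed_equivariantLp hν π
  have : CompleteSpace (equivariantLp hν π) := hE.completeSpace_coe
  have : Fact ((2 : ENNReal) ≠ ⊤) := ⟨ENNReal.ofNat_ne_top⟩
  obtain ⟨u, hu, hulim⟩ := hT.exists_invariant_tendsto (inducedRep hν π)
    -- For fixed `ω`, both `a (h⁻¹ • ω)` and `a ω` are single elements of `Γ`, each almost fixing `v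
    -- n`; dominated convergence on the finite measure `ν` concludes.
    (fun n => ⟨(hfL n).toLp, hfE n⟩) (by
      intro h
      rw [tendsto_zero_iff_norm_tendsto_zero]
      have h1 := tendsto_eLpNorm_two_zero_of_bounded (ν := ν) (C := 2)
        (f := fun n ω => f n (h⁻¹ • ω) - f n ω)
        (fun n => ((hfm n).comp_quasiMeasurePreserving (hν.qmp_right h⁻¹)).sub (hfm n))
        (fun n ω => (norm_sub_le _ _).trans (by rw [hfnorm, hfnorm]; norm_num))
        (fun ω => by simpa using (hv (a (h⁻¹ • ω))).sub (hv (a ω)))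
      have h2 := (ENNReal.continuousAt_toReal ENNReal.zero_ne_top).tendsto.comp h1
      refine (h2.congr fun n => ?_)
      rw [Function.comp_apply, Submodule.coe_norm, Lp.norm_def]
      congr 1
      refine eLpNorm_congr_ae ?_
      have h3 := (hfL n).coeFn_toLp
      have h4 := coeFn_inducedRep h (⟨(hfL n).toLp, hfE n⟩ : equivariantLp hν π)
      have h5 := Lp.coeFn_sub ((inducedRep hν π h ⟨(hfL n).toLp, hfE n⟩ : equivariantLp hν π) :
        Lp H 2 ν) (hfL n).toLp
      filter_upwards [h3, (hν.qmp_right h⁻¹).ae h3, h4, h5] with ω h6 h7 h8 h9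
      rw [Submodule.coe_sub, h9, Pi.sub_apply, h8, h6, h7])
  set F : ℕ → Ω → H := fun n => ((u n : equivariantLp hν π) : Lp H 2 ν) with hF
  have hFmeas : ∀ n, StronglyMeasurable (F n) := fun n => Lp.stronglyMeasurable _
  have hFΓ : ∀ n (g : Γ), (fun ω => F n (g • ω)) =ᵐ[m] fun ω => π g (F n ω) :=
    fun n g => hmν.ae_le ((u n).2 g)
  have hFΛ : ∀ n (h : Λ), (fun ω => F n (h • ω)) =ᵐ[m] F n := by
    intro n h
    have h1 := coeFn_inducedRep h⁻¹ (u n)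
    rw [hu, inv_inv] at h1
    exact hmν.ae_le h1.symm
  obtain ⟨ns, hns⟩ : ∃ ns : ℕ → ℕ, ∀ᵐ ω ∂m,
      Tendsto (fun k => F (ns k) ω - v (ns k)) atTop (𝓝 0) := by
    have h1 : Tendsto (fun n => ((u n : equivariantLp hν π) : Lp H 2 ν) - (hfL n).toLp) atTop
        (𝓝 0) := (continuous_subtype_val.tendsto _).comp hulim
    obtain ⟨ns, hmono, hns⟩ := (tendstoInMeasure_of_tendsto_Lp h1).exists_seq_tendsto_ae
    refine ⟨ns, hmν.ae_le ?_⟩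
    filter_upwards [hns, Lp.coeFn_zero H 2 ν, ae_all_iff.2 fun n => Lp.coeFn_sub
      ((u n : equivariantLp hν π) : Lp H 2 ν) (hfL n).toLp,
      ae_all_iff.2 fun n => (hfL n).coeFn_toLp] with ω h2 h3 h4 h5
    simp only [h3, h4, Pi.sub_apply, h5, Pi.zero_apply] at h2
    have h6 := h2.add ((hv (a ω)).comp hmono.tendsto_atTop)
    simpa [hf, Function.comp_def] using h6
  -- `F` is square integrable for `ν`, which says nothing about `m` on `B`. Truncation makes it
  -- bounded and preserves equivariance, invariance and closeness to the unit vectors.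
  set w : ℕ → H := fun k => ∫ ω in B, truncateVec 2 (F (ns k) ω) ∂m with hw
  have hwinv : ∀ k g, π g (w k) = w k := by
    intro k g
    refine hB.map_setIntegral_eq π (fun g => ?_) (fun h => ?_) g
    · filter_upwards [hFΓ (ns k) g] with ω hω
      rw [hω, map_truncateVec]
    · filter_upwards [hFΛ (ns k) h] with ω hω
      rw [hω]
  have : IsFiniteMeasure (m.restrict B) := ⟨by rwa [Measure.restrict_apply_univ]⟩
  have hGm : ∀ k, AEStronglyMeasurable (fun ω => truncateVec 2 (F (ns k) ω)) (m.restrict B) :=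
    fun k => (hFmeas (ns k)).truncateVec.aestronglyMeasurable
  have hwlim : Tendsto (fun k => w k - (m.real B) • v (ns k)) atTop (𝓝 0) := by
    have h1 : Tendsto (fun k => ∫ ω in B, (truncateVec 2 (F (ns k) ω) - v (ns k)) ∂m) atTop
        (𝓝 (∫ _ in B, (0 : H) ∂m)) := by
      refine tendsto_integral_of_dominated_convergence (fun _ => (3 : ℝ))
        (fun k => (hGm k).sub aestronglyMeasurable_const) (integrable_const _)
        (fun k => Eventually.of_forall fun ω => ?_) (ae_restrict_of_ae ?_)
      · refine (norm_sub_le _ _).trans ?_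
        rw [hv1]
        linarith [norm_truncateVec_le (F (ns k) ω)]
      · filter_upwards [hns] with ω hω
        exact squeeze_zero_norm (fun k => norm_truncateVec_sub_le _ (hv1 _))
          (tendsto_zero_iff_norm_tendsto_zero.1 hω)
    rw [integral_zero] at h1
    refine h1.congr fun k => ?_
    rw [integral_sub (Integrable.of_bound (hGm k) 2 (Eventually.of_forall fun ω =>
      norm_truncateVec_le _)) (integrable_const _), setIntegral_const]
  have hBpos : 0 < m.real B := ENNReal.toReal_pos (hB.measure_ne_zero hm) hBfin.ne
  obtain ⟨k, hk⟩ := ((tendsto_zero_iff_norm_tendsto_zero.1 hwlim).eventually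
    (gt_mem_nhds hBpos)).exists
  have hwk : w k ≠ 0 := by
    intro h0
    rw [h0, zero_sub, norm_neg, norm_smul, hv1, mul_one, Real.norm_of_nonneg hBpos.le] at hk
    exact lt_irrefl _ hk
  refine ⟨(‖w k‖⁻¹ : ℂ) • w k, ?_, fun g => by rw [map_smul, hwinv]⟩
  rw [norm_smul]
  simp [hwk]

theorem MeasureEquivalent.symm {Γ Λ : Type*} [Group Γ] [Group Λ] (h : MeasureEquivalent Γ Λ) :
    MeasureEquivalent Λ Γ := by
  obtain ⟨Ω, i₁, i₂, i₃, i₄, m, hm, hcomm, hpΓ, hpΛ, hA, hB⟩ := h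
  exact ⟨Ω, i₁, i₂, i₄, i₃, m, hm, SMulCommClass.symm Γ Λ Ω, hpΛ, hpΓ, hB, hA⟩

theorem proposition5 :
    (∀ {X₁ G₁ X₂ G₂ : Type*}
      [MeasurableSpace X₁] [StandardBorelSpace X₁] [MeasurableSpace G₁] [StandardBorelSpace G₁]
      [MeasurableSpace X₂] [StandardBorelSpace X₂] [MeasurableSpace G₂] [StandardBorelSpace G₂]
      (𝒢₁ : MeasuredGroupoid X₁ G₁) (𝒢₂ : MeasuredGroupoid X₂ G₂),
      𝒢₁.IsRDiscrete → 𝒢₁.IsErgodic → 𝒢₂.IsRDiscrete → 𝒢₂.IsErgodic →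
      𝒢₁.Similar 𝒢₂ → (𝒢₁.HasPropertyT ↔ 𝒢₂.HasPropertyT)) ∧
    (∀ {Γ Λ : Type*} [Group Γ] [Countable Γ] [Group Λ] [Countable Λ],
      MeasureEquivalent Γ Λ → (GroupHasPropertyT Γ ↔ GroupHasPropertyT Λ)) :=
  ⟨fun _ _ hd₁ _ hd₂ _ h => h.hasPropertyT_iff hd₁ hd₂,
    fun h => ⟨fun hT => hT.of_measureEquivalent h.symm, fun hT => hT.of_measureEquivalent h⟩⟩
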